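/- Let $P$ be a pair of pants with $\pi_1(P)=\langle\alpha,\beta,\gamma\mid\alpha\beta\gamma=1\rangle$, where $\alpha,\beta,\gamma$ are the peripheral loops. A *framed representation* is a homomorphism $\rho:\pi_1(P)\to\mathrm{PSL}(3,\mathbb R)=\mathrm{SL}(3,\mathbb R)$ together with full flags $F_c=(p_c,\ell_c)$ of $\mathbb R^3$, $c\in\{\alpha,\beta,\gamma\}$, with $\rho(c)F_c=F_c$. For flags $F_i=(p_i,\ell_i)$, $\ell_i$ a linear functional up to scale with $\ell_i(p_i)=0$, and $\overline{pq}=\det(p,q,\cdot)$, put $$\mathsf{cr}_1(F_1,F_2,F_3,F_4)=-\frac{\ell_1(p_2)\,\overline{p_1p_3}(p_4)}{\ell_1(p_4)\,\overline{p_1p_3}(p_2)},\quad \mathsf{cr}_2(F_1,F_2,F_3,F_4)=-\frac{\ell_3(p_4)\,\overline{p_1p_3}(p_2)}{\ell_3(p_2)\,\overline{p_1p_3}(p_4)},\quad \mathsf T(F_1,F_2,F_3)=\frac{\ell_1(p_2)\ell_2(p_3)\ell_3(p_1)}{\ell_1(p_3)\ell_2(p_1)\ell_3(p_2)}.$$ The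 Fock–Goncharov coordinates $(X_1,\dots,X_8)=(\sigma_1,\dots,\sigma_6,\tau_1,\tau_2)$ of $(\rho,F_\alpha,F_\beta,F_\gamma)$ (for the triangulation of $P$, with boundary components shrunk to punctures, by two ideal triangles) are $$\sigma_2,\sigma_1=\mathsf{cr}_1,\mathsf{cr}_2(F_\alpha,\rho(\alpha)F_\beta,F_\gamma,F_\beta),\quad \sigma_3,\sigma_4=\mathsf{cr}_1,\mathsf{cr}_2(F_\alpha,F_\gamma,F_\beta,\rho(\beta)F_\gamma),\quad \sigma_6,\sigma_5=\mathsf{cr}_1,\mathsf{cr}_2(F_\gamma,\rho(\gamma)F_\alpha,F_\beta,F_\alpha),$$ $$\tau_1=\mathsf T(F_\alpha,F_\gamma,F_\beta),\qquad \tau_2=\mathsf T(F_\alpha,\rho(\alpha)F_\beta,F_\gamma).$$ The framed representation is *positive* if the flags in each of these three quadruples are pairwise transverse and all eight coordinates are positive. Let $\widehat{\mathfrak C}(P)$ be the space of framed convex projective structures on $P$, that is, of positive framed representations up to the action of $\mathrm{PSL}(3,\mathbb R)$ (conjugating $\rho$ and translating the flags). The coordinates identify it with $\mathbb R^8_{>0}$,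 which gives its smooth structure; its Poisson structure is $\{X_i,X_j\}=2\varepsilon_{ij}X_iX_j$, where $\varepsilon$ is antisymmetric, $\varepsilon_{i7}=(-1)^{i+1}=-\varepsilon_{i8}$ for $1\le i\le 6$, and all other entries above the diagonal vanish. The Hamiltonian vector field $H_f$ of a smooth function $f$ is defined by $dg(H_f)=\{g,f\}$ for all smooth $g$. A *symplectic leaf* is an equivalence class of points that can be joined by a finite composition of time-one maps of Hamiltonian flows; its symplectic form $\omega$ is given by $\omega(H_f,H_g)=\{f,g\}$, so the Hamiltonian vector field of $f|_{\mathcal Q}$ is $H_f|_{\mathcal Q}$. **Theorem.** Let $\delta=\alpha\gamma^{-1}$ be the figure eight curve on $P$, let $\mathsf{tr}_\delta:\widehat{\mathfrak C}(P)\to\mathbb R$, $[\rho,F]\mapsto\mathrm{tr}\,\rho(\delta)$, and let $\mathcal Q\subset\widehat{\mathfrak C}(P)$ be any symplectic leaf. Then $\mathcal Q$ is a two-dimensional embedded submanifold, $\mathsf{tr}_\delta$ is smooth, and $\mathsf{tr}_\delta|_{\mathcal Q}:\mathcal Q\to\mathbb R$ attains its minimum at exactly one point. Moreover, the Hamiltonian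 flow of $\mathsf{tr}_\delta|_{\mathcal Q}$ is defined on $\mathcal Q$ for all times, every orbit of it is periodic, and it has exactly one fixed point. -/

import Mathlib

open scoped LinearAlgebra.Projectivization Matrix ContDiff

namespace Pants

/-! ### Flags in the real projective plane and their invariants -/

/-- The group `PSL(3, ℝ)`. The centre of `SL(3, ℝ)` is trivial, because `1` is the only real cube
root of unity, so `PSL(3, ℝ)` is `SL(3, ℝ)` itself and traces make sense. -/
abbrev PSL3 : Type := Matrix.SpecialLinearGroup (Fin 3) ℝ

/-- The real projective plane. Points are classes of column vectors; points of the dual plane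
(projective lines) are classes of row vectors, i.e. of linear functionals. -/
abbrev RP2 : Type := ℙ ℝ (Fin 3 → ℝ)

/-- A full flag of `ℝ³`: a point `p` and a projective class `ℓ` of linear functionals with
`ℓ(p) = 0`. -/
@[ext]
structure Flag where
  point : RP2
  line : RP2
  incident : line.orthogonal point

/-- The number `ℓ(p)`, for chosen representatives of the functional and of the point. -/
noncomputable def pair (ℓ p : RP2) : ℝ := ℓ.rep ⬝ᵥ p.rep

/-- The value at `r` of the functional `x ↦ det (p, q, x)`, whose kernel is the projective line
through `p` and `q`, for chosen representatives. -/
noncomputable def lineThrough (p q r : RP2) : ℝ := Matrix.det (Matrix.of ![p.rep, q.rep, r.rep])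

/-- Two flags are transverse if neither line contains the other point. -/
def Flag.Transverse (F G : Flag) : Prop :=
  ¬ F.line.orthogonal G.point ∧ ¬ G.line.orthogonal F.point

/-- A quadruple of flags that are pairwise transverse. -/
def TransverseQuadruple (F₁ F₂ F₃ F₄ : Flag) : Prop :=
  F₁.Transverse F₂ ∧ F₁.Transverse F₃ ∧ F₁.Transverse F₄ ∧
    F₂.Transverse F₃ ∧ F₂.Transverse F₄ ∧ F₃.Transverse F₄

/-- The first cross ratio of a quadruple of flags. Like the two invariants below, it does not
depend on the choice of representatives. -/
noncomputable def cr₁ (F₁ F₂ F₃ F₄ : Flag) : ℝ :=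
  -((pair F₁.line F₂.point * lineThrough F₁.point F₃.point F₄.point) /
    (pair F₁.line F₄.point * lineThrough F₁.point F₃.point F₂.point))

/-- The second cross ratio of a quadruple of flags. -/
noncomputable def cr₂ (F₁ F₂ F₃ F₄ : Flag) : ℝ :=
  -((pair F₃.line F₄.point * lineThrough F₁.point F₃.point F₂.point) /
    (pair F₃.line F₂.point * lineThrough F₁.point F₃.point F₄.point))

/-- The triple ratio of a triple of flags. -/
noncomputable def tripleRatio (F₁ F₂ F₃ : Flag) : ℝ :=
  (pair F₁.line F₂.point * pair F₂.line F₃.point * pair F₃.line F₁.point) /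
    (pair F₁.line F₃.point * pair F₂.line F₁.point * pair F₃.line F₂.point)

/-! ### The action of the projective group on flags -/

theorem sl_smul_eq (g : PSL3) (v : Fin 3 → ℝ) : g • v = g.1 *ᵥ v := rfl

theorem dual_dotProduct (g : PSL3) (v w : Fin 3 → ℝ) :
    ((g⁻¹).transpose.1 *ᵥ v) ⬝ᵥ (g.1 *ᵥ w) = v ⬝ᵥ w := by
  have h : (g⁻¹).1 * g.1 = 1 := by
    rw [← Matrix.SpecialLinearGroup.coe_mul, inv_mul_cancel, Matrix.SpecialLinearGroup.coe_one]
  have h2 : (g⁻¹).transpose.1 = ((g⁻¹).1)ᵀ := rfl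
  rw [h2, Matrix.mulVec_transpose, ← Matrix.dotProduct_mulVec, Matrix.mulVec_mulVec, h,
    Matrix.one_mulVec]

theorem orthogonal_smul (g : PSL3) {ℓ p : RP2} (h : ℓ.orthogonal p) :
    ((g⁻¹).transpose • ℓ).orthogonal (g • p) := by
  induction ℓ using Projectivization.ind with | h v hv =>
  induction p using Projectivization.ind with | h w hw =>
  rw [Projectivization.smul_mk, Projectivization.smul_mk, Projectivization.orthogonal_mk,
    sl_smul_eq, sl_smul_eq, dual_dotProduct]
  exact (Projectivization.orthogonal_mk hv hw).1 h

/-- `g` acts on points by `p ↦ g p` and on functionals by `ℓ ↦ ℓ g⁻¹`; in terms of column vectors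
the latter is multiplication by the transpose of `g⁻¹`. -/
noncomputable instance : MulAction PSL3 Flag where
  smul g F := ⟨g • F.point, (g⁻¹).transpose • F.line, orthogonal_smul g F.incident⟩
  one_smul F := by
    have h : ((1 : PSL3)⁻¹).transpose = 1 := by
      ext i j; simp [Matrix.one_apply, eq_comm]
    refine Flag.ext (one_smul PSL3 F.point) ?_
    change ((1 : PSL3)⁻¹).transpose • F.line = F.line
    rw [h, one_smul]
  mul_smul g h F := by
    have e : ((g * h)⁻¹).transpose = (g⁻¹).transpose * (h⁻¹).transpose := by
      apply Subtype.ext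
      change ((g * h)⁻¹).1ᵀ = (g⁻¹).1ᵀ * (h⁻¹).1ᵀ
      rw [mul_inv_rev, Matrix.SpecialLinearGroup.coe_mul, Matrix.transpose_mul]
    refine Flag.ext (mul_smul g h F.point) ?_
    change ((g * h)⁻¹).transpose • F.line = (g⁻¹).transpose • ((h⁻¹).transpose • F.line)
    rw [e, mul_smul]

theorem exists_rep_smul (g : PSL3) (p : RP2) :
    ∃ a : ℝ, a ≠ 0 ∧ (g • p).rep = a • (g.1 *ᵥ p.rep) := by
  have hp : g • p.rep ≠ 0 := (smul_ne_zero_iff_ne g).mpr p.rep_nonzero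
  obtain ⟨a, ha⟩ := Projectivization.exists_smul_eq_mk_rep ℝ (g • p.rep) hp
  refine ⟨a, a.ne_zero, ?_⟩
  rw [← Projectivization.smul_mk g p.rep_nonzero, Projectivization.mk_rep] at ha
  exact ha.symm

theorem exists_scaling (g : PSL3) : ∃ a b : RP2 → ℝ, (∀ p, a p ≠ 0) ∧ (∀ ℓ, b ℓ ≠ 0) ∧
    (∀ ℓ p, pair ((g⁻¹).transpose • ℓ) (g • p) = b ℓ * a p * pair ℓ p) ∧
    (∀ p q r, lineThrough (g • p) (g • q) (g • r) = a p * a q * a r * lineThrough p q r) := by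
  choose a ha ha' using exists_rep_smul g
  choose b hb hb' using exists_rep_smul (g⁻¹).transpose
  refine ⟨a, b, ha, hb, fun ℓ p => ?_, fun p q r => ?_⟩
  · rw [pair, ha', hb', smul_dotProduct, dotProduct_smul, dual_dotProduct, pair, smul_eq_mul,
      smul_eq_mul, mul_assoc]
  · have e : Matrix.of ![(g • p).rep, (g • q).rep, (g • r).rep] =
        Matrix.diagonal ![a p, a q, a r] *
          (Matrix.of ![p.rep, q.rep, r.rep] * g.1ᵀ) := by
      ext i j
      rw [Matrix.diagonal_mul]
      fin_cases i <;>
        simp [ha', Matrix.mul_apply, Matrix.mulVec, dotProduct, mul_comm]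
    rw [lineThrough, e, Matrix.det_mul, Matrix.det_mul, Matrix.det_transpose, g.2,
      Matrix.det_diagonal, Fin.prod_univ_three, lineThrough]
    simp

theorem cr₁_smul (g : PSL3) (F₁ F₂ F₃ F₄ : Flag) :
    cr₁ (g • F₁) (g • F₂) (g • F₃) (g • F₄) = cr₁ F₁ F₂ F₃ F₄ := by
  obtain ⟨a, b, ha, hb, h, h'⟩ := exists_scaling g
  change -((pair ((g⁻¹).transpose • F₁.line) (g • F₂.point) *
      lineThrough (g • F₁.point) (g • F₃.point) (g • F₄.point)) /
    (pair ((g⁻¹).transpose • F₁.line) (g • F₄.point) *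
      lineThrough (g • F₁.point) (g • F₃.point) (g • F₂.point))) = _
  rw [h, h, h', h', cr₁]
  have hk : b F₁.line * a F₁.point * a F₂.point * a F₃.point * a F₄.point ≠ 0 := by
    simp [ha, hb]
  refine congrArg Neg.neg (Eq.trans ?_ (mul_div_mul_left _ _ hk))
  congr 1 <;> ring

theorem cr₂_smul (g : PSL3) (F₁ F₂ F₃ F₄ : Flag) :
    cr₂ (g • F₁) (g • F₂) (g • F₃) (g • F₄) = cr₂ F₁ F₂ F₃ F₄ := by
  obtain ⟨a, b, ha, hb, h, h'⟩ := exists_scaling g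
  change -((pair ((g⁻¹).transpose • F₃.line) (g • F₄.point) *
      lineThrough (g • F₁.point) (g • F₃.point) (g • F₂.point)) /
    (pair ((g⁻¹).transpose • F₃.line) (g • F₂.point) *
      lineThrough (g • F₁.point) (g • F₃.point) (g • F₄.point))) = _
  rw [h, h, h', h', cr₂]
  have hk : b F₃.line * a F₁.point * a F₂.point * a F₃.point * a F₄.point ≠ 0 := by
    simp [ha, hb]
  refine congrArg Neg.neg (Eq.trans ?_ (mul_div_mul_left _ _ hk))
  congr 1 <;> ring

theorem tripleRatio_smul (g : PSL3) (F₁ F₂ F₃ : Flag) :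
    tripleRatio (g • F₁) (g • F₂) (g • F₃) = tripleRatio F₁ F₂ F₃ := by
  obtain ⟨a, b, ha, hb, h, -⟩ := exists_scaling g
  change (pair ((g⁻¹).transpose • F₁.line) (g • F₂.point) *
      pair ((g⁻¹).transpose • F₂.line) (g • F₃.point) *
      pair ((g⁻¹).transpose • F₃.line) (g • F₁.point)) /
    (pair ((g⁻¹).transpose • F₁.line) (g • F₃.point) *
      pair ((g⁻¹).transpose • F₂.line) (g • F₁.point) *
      pair ((g⁻¹).transpose • F₃.line) (g • F₂.point)) = _
  simp only [h]
  rw [tripleRatio]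
  have hk : b F₁.line * b F₂.line * b F₃.line * a F₁.point * a F₂.point * a F₃.point ≠ 0 := by
    simp [ha, hb]
  refine Eq.trans ?_ (mul_div_mul_left _ _ hk)
  congr 1 <;> ring

/-! ### Framed representations of the fundamental group of a pair of pants -/

/-- The three peripheral loops of a pair of pants `P`. -/
inductive Peripheral
  | α
  | β
  | γ

/-- The fundamental group `⟨α, β, γ | α β γ = 1⟩` of a pair of pants `P`. -/
abbrev π₁P : Type :=
  PresentedGroup
    ({FreeGroup.of .α * FreeGroup.of .β * FreeGroup.of .γ} : Set (FreeGroup Peripheral))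

/-- The class of a peripheral loop in the fundamental group. -/
def loop (c : Peripheral) : π₁P := PresentedGroup.of c

/-- The figure eight curve `δ = α γ⁻¹`. -/
def figureEight : π₁P := loop .α * (loop .γ)⁻¹

/-- A framed representation: a representation of the fundamental group together with, for each
peripheral loop, a flag fixed by its image. -/
@[ext]
structure FramedRep where
  rho : π₁P →* PSL3
  flag : Peripheral → Flag
  fixed : ∀ c, rho (loop c) • flag c = flag c

/-- The projective group acts by conjugation on representations and by translation on flags. -/
noncomputable instance : MulAction PSL3 FramedRep where
  smul g R :=
    { rho := (MulAut.conj g).toMonoidHom.comp R.rho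
      flag := fun c => g • R.flag c
      fixed := fun c => by
        change (g * R.rho (loop c) * g⁻¹) • g • R.flag c = g • R.flag c
        rw [smul_smul, inv_mul_cancel_right, mul_smul, R.fixed] }
  one_smul R := by
    refine FramedRep.ext ?_ ?_
    · ext1 x
      change 1 * R.rho _ * 1⁻¹ = R.rho _
      simp
    · funext c
      exact one_smul PSL3 (R.flag c)
  mul_smul g h R := by
    refine FramedRep.ext ?_ ?_
    · ext1 x
      change (g * h) * R.rho _ * (g * h)⁻¹ = g * (h * R.rho _ * h⁻¹) * g⁻¹
      group
    · funext c
      exact mul_smul g h (R.flag c)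

namespace FramedRep

variable (R : FramedRep)

/-! Shrink the boundary components to punctures `p_α, p_β, p_γ` and triangulate `P` by two ideal
triangles with these vertices. In the universal cover, let `v_α, v_γ, v_β`, in counterclockwise
order, be the vertices of a lift of the first triangle, fixed by `α`, `γ`, `β`. The triangles
adjacent to it, which are lifts of the second triangle, have as their third vertices
`α v_β = γ⁻¹ v_β` (across the edge `v_α v_γ`), `β v_γ = α⁻¹ v_γ` (across `v_α v_β`) and
`γ v_α = β⁻¹ v_α` (across `v_γ v_β`). A framed representation attaches a flag to every vertex of
the lifted triangulation, equivariantly; these are the flags at the vertices just listed. -/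

/-- The flag at `v_α`. -/
def Fα : Flag := R.flag .α

/-- The flag at `v_β`. -/
def Fβ : Flag := R.flag .β

/-- The flag at `v_γ`. -/
def Fγ : Flag := R.flag .γ

/-- The flag at `α v_β`. -/
noncomputable def Gβ : Flag := R.rho (loop .α) • R.flag .β

/-- The flag at `β v_γ`. -/
noncomputable def Gγ : Flag := R.rho (loop .β) • R.flag .γ

/-- The flag at `γ v_α`. -/
noncomputable def Gα : Flag := R.rho (loop .γ) • R.flag .α

/-- The Fock-Goncharov coordinates `(σ₁, …, σ₆, τ₁, τ₂)`. The edge from `p_α` to `p_γ` carries `σ₂`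
(near `p_α`) and `σ₁` (near `p_γ`), the edge from `p_α` to `p_β` carries `σ₃` (near `p_α`) and `σ₄`
(near `p_β`), the edge from `p_γ` to `p_β` carries `σ₆` (near `p_γ`) and `σ₅` (near `p_β`). In each
quadruple the vertices are listed counterclockwise, starting at an endpoint of the edge; the
first cross ratio is attached to this endpoint and the second one to the other endpoint. The triple
ratios `τ₁, τ₂` belong to the two triangles. -/
noncomputable def coords : Fin 8 → ℝ :=
  ![cr₂ R.Fα R.Gβ R.Fγ R.Fβ, cr₁ R.Fα R.Gβ R.Fγ R.Fβ,
    cr₁ R.Fα R.Fγ R.Fβ R.Gγ, cr₂ R.Fα R.Fγ R.Fβ R.Gγ,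
    cr₂ R.Fγ R.Gα R.Fβ R.Fα, cr₁ R.Fγ R.Gα R.Fβ R.Fα,
    tripleRatio R.Fα R.Fγ R.Fβ, tripleRatio R.Fα R.Gβ R.Fγ]

/-- A framed representation is positive if the flags at the vertices of adjacent triangles are
pairwise transverse and all its Fock-Goncharov coordinates are positive. -/
def IsPositive : Prop :=
  TransverseQuadruple R.Fα R.Gβ R.Fγ R.Fβ ∧ TransverseQuadruple R.Fα R.Fγ R.Fβ R.Gγ ∧
    TransverseQuadruple R.Fγ R.Gα R.Fβ R.Fα ∧ ∀ i, 0 < R.coords i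

/-- The trace function of an element `c` of the fundamental group. -/
def trace (c : π₁P) : ℝ := Matrix.trace (R.rho c).1

theorem coords_smul (g : PSL3) : (g • R).coords = R.coords := by
  have e (c d : Peripheral) : (g • R).rho (loop c) • (g • R).flag d =
      g • (R.rho (loop c) • R.flag d) := by
    change (g * R.rho (loop c) * g⁻¹) • g • R.flag d = _
    rw [smul_smul, inv_mul_cancel_right, mul_smul]
  have e' (c : Peripheral) : (g • R).flag c = g • R.flag c := rfl
  simp only [coords, Fα, Fβ, Fγ, Gα, Gβ, Gγ, e]
  simp only [e', cr₁_smul, cr₂_smul, tripleRatio_smul]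

theorem trace_smul (g : PSL3) (c : π₁P) : (g • R).trace c = R.trace c := by
  change Matrix.trace (g * R.rho c * g⁻¹ : PSL3).1 = Matrix.trace (R.rho c).1
  rw [Matrix.SpecialLinearGroup.coe_mul, Matrix.trace_mul_comm, ← Matrix.SpecialLinearGroup.coe_mul,
    ← mul_assoc, inv_mul_cancel, one_mul]

end FramedRep

/-- The space of framed representations up to conjugation. -/
abbrev FramedCharacterVariety : Type := MulAction.orbitRel.Quotient PSL3 FramedRep

/-- The space `Ĉ(P)` of framed convex projective structures on the pair of pants, as the space of
positive framed representations up to conjugation. -/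
abbrev FramedConvex : Type :=
  {x : FramedCharacterVariety // ∃ R : FramedRep, R.IsPositive ∧ Quotient.mk _ R = x}

namespace FramedConvex

/-- The Fock-Goncharov coordinates of a framed convex projective structure. -/
noncomputable def coords (x : FramedConvex) : Fin 8 → ℝ :=
  Quotient.lift FramedRep.coords
    (by rintro _ R ⟨g, rfl⟩; exact R.coords_smul g) x.1

/-- The trace function `tr_c : Ĉ(P) → ℝ` of a closed curve `c`. -/
noncomputable def tr (c : π₁P) (x : FramedConvex) : ℝ :=
  Quotient.lift (fun R : FramedRep => R.trace c)
    (by rintro _ R ⟨g, rfl⟩; exact R.trace_smul g c) x.1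

/-! ### The Poisson structure, symplectic leaves and Hamiltonian flows -/

/-- The open orthant in which the coordinates take their values. -/
def orthant : Set (Fin 8 → ℝ) := {y | ∀ i, 0 < y i}

/-- The expression of a function on `Ĉ(P)` in Fock-Goncharov coordinates, extended by `0` outside
the image of the coordinate map. -/
noncomputable def inCoords (f : FramedConvex → ℝ) : (Fin 8 → ℝ) → ℝ := Function.extend coords f 0

/-- Smooth functions on `Ĉ(P)`, with respect to the smooth structure given by the Fock-Goncharov
coordinates, which identify `Ĉ(P)` with the open orthant. -/
def IsSmooth (f : FramedConvex → ℝ) : Prop := ContDiffOn ℝ ∞ (inCoords f) orthant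

/-- The partial derivative of a function with respect to the `i`-th coordinate. -/
noncomputable def partialDeriv (f : FramedConvex → ℝ) (i : Fin 8) (x : FramedConvex) : ℝ :=
  fderiv ℝ (inCoords f) (coords x) (Pi.single i 1)

/-- The exchange matrix of the quiver of the triangulation: the number of arrows from `i` to `j`
minus the number of arrows from `j` to `i`. -/
def exchange : Matrix (Fin 8) (Fin 8) ℝ :=
  !![0, 0, 0, 0, 0, 0, 1, -1;
     0, 0, 0, 0, 0, 0, -1, 1;
     0, 0, 0, 0, 0, 0, 1, -1;
     0, 0, 0, 0, 0, 0, -1, 1;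
     0, 0, 0, 0, 0, 0, 1, -1;
     0, 0, 0, 0, 0, 0, -1, 1;
     -1, 1, -1, 1, -1, 1, 0, 0;
     1, -1, 1, -1, 1, -1, 0, 0]

/-- The Fock-Goncharov Poisson bracket, determined by `{Xᵢ, Xⱼ} = 2 εᵢⱼ Xᵢ Xⱼ` on coordinates. -/
noncomputable def bracket (f g : FramedConvex → ℝ) (x : FramedConvex) : ℝ :=
  ∑ i, ∑ j, 2 * exchange i j * coords x i * coords x j * partialDeriv f i x * partialDeriv g j x

/-- `c` is, for times in `s`, an integral curve of the Hamiltonian vector field `H_f` of `f`, the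
vector field with `dg(H_f) = {g, f}` for every smooth `g`. -/
def IsHamiltonianCurveOn (f : FramedConvex → ℝ) (c : ℝ → FramedConvex) (s : Set ℝ) : Prop :=
  ∀ g, IsSmooth g → ∀ t ∈ s, HasDerivWithinAt (fun u => g (c u)) (bracket g f (c t)) s t

/-- `q` is the image of `p` under the time-one map of the Hamiltonian flow of a smooth function. -/
def HamiltonianStep (p q : FramedConvex) : Prop :=
  ∃ f, IsSmooth f ∧ ∃ c : ℝ → FramedConvex,
    IsHamiltonianCurveOn f c (Set.Icc 0 1) ∧ c 0 = p ∧ c 1 = q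

/-- A symplectic leaf: the set of all points that can be reached from a given one by composing
finitely many time-one maps of Hamiltonian flows. -/
def IsSymplecticLeaf (Q : Set FramedConvex) : Prop :=
  ∃ p, Q = {q | Relation.ReflTransGen HamiltonianStep p q}

/-- `Φ` is the Hamiltonian flow of `f` on the symplectic leaf `Q`, for all times. The symplectic form
of `Q` is given by `ω(H_f, H_g) = {f, g}`, so that the Hamiltonian vector field of the restriction of
`f` to `Q` is the restriction of `H_f`. -/
structure IsHamiltonianFlow (f : FramedConvex → ℝ) (Q : Set FramedConvex) (Φ : ℝ → Q → Q) :
    Prop where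
  zero : ∀ q, Φ 0 q = q
  curve : ∀ q, IsHamiltonianCurveOn f (fun t => (Φ t q : FramedConvex)) Set.univ
  unique : ∀ (q : Q) (c : ℝ → FramedConvex) (s : Set ℝ), s.OrdConnected → 0 ∈ s →
    IsHamiltonianCurveOn f c s → c 0 = q → ∀ t ∈ s, c t = Φ t q

end FramedConvex

/-- An embedded smooth surface in `ℝ⁸`: a set that is locally the image of an open subset of the
plane under a smooth immersion that is a homeomorphism onto its image. -/
def IsEmbeddedSurface (S : Set (Fin 8 → ℝ)) : Prop :=
  ∀ y ∈ S, ∃ U : Set (Fin 8 → ℝ), IsOpen U ∧ y ∈ U ∧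
    ∃ (V : Set (Fin 2 → ℝ)) (ψ : (Fin 2 → ℝ) → (Fin 8 → ℝ)), IsOpen V ∧ ContDiffOn ℝ ∞ ψ V ∧
      (∀ v ∈ V, Function.Injective (fderiv ℝ ψ v)) ∧ Topology.IsEmbedding (V.domRestrict ψ) ∧
      ψ '' V = S ∩ U

end Pants

/-!
The proof computes everything in Fock-Goncharov coordinates.

*Coordinates.* A positive framed representation can be moved by the projective group so that the
flags of the first ideal triangle are in a standard position that depends only on the triple ratio
`τ₁` (`exists_smul_isRep_standard`). The three pairs of cross ratios and `τ₂` then determine the flags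
at the three neighbouring vertices by explicit formulas (`FramedRep.IsNormal`). Since an element of
`PSL(3, ℝ)` is determined by its action on a triple of flags in general position, so are the images
of `α` and `γ`, which gives injectivity of the coordinate map (`FramedConvex.coords_injective`).
Conversely, explicit matrices for `α` and `γ⁻¹` realise all positive values of the coordinates
(`exists_isNormal`); with `β` defined by the relation `α β γ = 1`, the required action on flags is a
finite check. The trace of the product of the two matrices is the trace of the figure eight curve:
a polynomial with positive coefficients, divided by the cube root of a monomial (`traceForm`).

*Leaves.* In logarithmic coordinates the Poisson tensor is constant of rank two, `u vᵀ - v uᵀ` up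
to a factor. Hence the leaves are the affine planes spanned by `u` and `v`, with parameters `a, b`,
and Hamiltonian curves correspond to integral curves of the Hamiltonian vector field on the
`(a, b)`-plane with bracket `{a, b} = 2` (`FramedConvex.leaf_eq_range`,
`FramedConvex.IsSmooth.exists_lift`). The plane is identified with `ℂ`.

*Dynamics.* On each leaf the monomial under the cube root is constant, and the trace becomes a sum
of exponentials of linear forms `m a + n b` with positive coefficients. The exponents are the points
`(m, n)` with `-2 ≤ m ≤ 1` and `-1 ≤ n ≤ 1`, whose convex hull is a neighbourhood of the origin. So
the restriction of the trace is strictly convex and proper (`strictConvexOn_expSum`,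
`tendsto_expSum`), and it has exactly one minimum and no other critical point. Its Hamiltonian flow
preserves compact level sets, so it is complete, and off the minimum it turns around the minimum
with angular velocity bounded away from zero. After a full turn an orbit meets its initial ray at
the same level, that is, in its initial point (`FramedConvex.exists_periodic`).
-/

namespace Pants

/-! ### Flags given by representatives -/

/-- `v` and `w` represent the point and the line of the flag `F`, up to nonzero factors. -/
def Flag.IsRep (F : Flag) (v w : Fin 3 → ℝ) : Prop :=
  ∃ a b : ℝ, a ≠ 0 ∧ b ≠ 0 ∧ F.point.rep = a • v ∧ F.line.rep = b • w

/-- The value at `c` of the functional `det (a, b, ·)`. -/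
noncomputable def det₃ (a b c : Fin 3 → ℝ) : ℝ := Matrix.det (Matrix.of ![a, b, c])

theorem Flag.isRep_rep (F : Flag) : F.IsRep F.point.rep F.line.rep :=
  ⟨1, 1, one_ne_zero, one_ne_zero, (one_smul ℝ _).symm, (one_smul ℝ _).symm⟩

theorem orthogonal_iff_rep (ℓ p : RP2) : ℓ.orthogonal p ↔ ℓ.rep ⬝ᵥ p.rep = 0 := by
  conv_lhs => rw [← ℓ.mk_rep, ← p.mk_rep]
  exact Projectivization.orthogonal_mk _ _

theorem det₃_smul (a b c : ℝ) (u v w : Fin 3 → ℝ) :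
    det₃ (a • u) (b • v) (c • w) = a * b * c * det₃ u v w := by
  simp only [det₃, Matrix.det_fin_three, Matrix.of_apply, Matrix.cons_val, Pi.smul_apply,
    smul_eq_mul]
  ring

namespace Flag.IsRep

variable {F F₁ F₂ F₃ F₄ G : Flag} {v w v₁ w₁ v₂ w₂ v₃ w₃ v₄ w₄ : Fin 3 → ℝ}

theorem eq (hF : F.IsRep v w) (hG : G.IsRep v w) : F = G := by
  obtain ⟨a, b, ha, hb, h, h'⟩ := hF
  obtain ⟨c, d, hc, hd, k, k'⟩ := hG
  refine Flag.ext ?_ ?_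
  · rw [← F.point.mk_rep, ← G.point.mk_rep, Projectivization.mk_eq_mk_iff']
    exact ⟨a / c, by rw [h, k, smul_smul, div_mul_cancel₀ _ hc]⟩
  · rw [← F.line.mk_rep, ← G.line.mk_rep, Projectivization.mk_eq_mk_iff']
    exact ⟨b / d, by rw [h', k', smul_smul, div_mul_cancel₀ _ hd]⟩

theorem dotProduct_eq_zero (hF : F.IsRep v w) : w ⬝ᵥ v = 0 := by
  obtain ⟨a, b, ha, hb, h, h'⟩ := hF
  have := (orthogonal_iff_rep _ _).1 F.incident
  rw [h, h', smul_dotProduct, dotProduct_smul] at this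
  simpa [ha, hb] using this

theorem smul_right {a b : ℝ} {v' w' : Fin 3 → ℝ} (hF : F.IsRep v w) (hv : v = a • v')
    (hw : w = b • w') : F.IsRep v' w' := by
  obtain ⟨c, d, hc, hd, h, h'⟩ := hF
  refine ⟨c * a, d * b, mul_ne_zero hc ?_, mul_ne_zero hd ?_, by rw [h, hv, smul_smul],
    by rw [h', hw, smul_smul]⟩
  · rintro rfl
    exact F.point.rep_nonzero (by rw [h, hv, zero_smul, smul_zero])
  · rintro rfl
    exact F.line.rep_nonzero (by rw [h', hw, zero_smul, smul_zero])

/-- The action of `g` on a flag in terms of representatives, without inverse matrices. -/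
theorem smul {c d : ℝ} {v' w' : Fin 3 → ℝ} (hF : F.IsRep v w) (g : PSL3) (hv : g.1 *ᵥ v = c • v')
    (hw : w' ᵥ* g.1 = d • w) (hd : d ≠ 0) : (g • F).IsRep v' w' := by
  obtain ⟨a, b, ha, hb, h, h'⟩ := hF
  obtain ⟨a₁, ha₁, k⟩ := exists_rep_smul g F.point
  obtain ⟨b₁, hb₁, k'⟩ := exists_rep_smul (g⁻¹).transpose F.line
  have key : (g⁻¹).transpose.1 *ᵥ w = d⁻¹ • w' := by
    have h1 : g.1 * (g⁻¹).1 = 1 := by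
      rw [← Matrix.SpecialLinearGroup.coe_mul, mul_inv_cancel, Matrix.SpecialLinearGroup.coe_one]
    have h2 : (g⁻¹).transpose.1 = ((g⁻¹).1)ᵀ := rfl
    have h3 : w = d⁻¹ • (w' ᵥ* g.1) := by rw [hw, smul_smul, inv_mul_cancel₀ hd, one_smul]
    rw [h2, Matrix.mulVec_transpose, h3, Matrix.smul_vecMul, Matrix.vecMul_vecMul, h1,
      Matrix.vecMul_one]
  refine smul_right (g • F).isRep_rep (a := a₁ * a * c) (b := b₁ * b * d⁻¹) ?_ ?_
  · change (g • F.point).rep = _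
    rw [k, h, Matrix.mulVec_smul, hv, smul_smul, smul_smul, mul_assoc]
  · change ((g⁻¹).transpose • F.line).rep = _
    rw [k', h', Matrix.mulVec_smul, key, smul_smul, smul_smul, mul_assoc]

theorem transverse_iff (h₁ : F₁.IsRep v₁ w₁) (h₂ : F₂.IsRep v₂ w₂) :
    F₁.Transverse F₂ ↔ w₁ ⬝ᵥ v₂ ≠ 0 ∧ w₂ ⬝ᵥ v₁ ≠ 0 := by
  obtain ⟨a, b, ha, hb, h, h'⟩ := h₁
  obtain ⟨c, d, hc, hd, k, k'⟩ := h₂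
  rw [Flag.Transverse, orthogonal_iff_rep, orthogonal_iff_rep, h, h', k, k']
  simp only [smul_dotProduct, dotProduct_smul, smul_eq_mul]
  simp [ha, hb, hc, hd]

theorem cr₁_eq (h₁ : F₁.IsRep v₁ w₁) (h₂ : F₂.IsRep v₂ w₂) (h₃ : F₃.IsRep v₃ w₃)
    (h₄ : F₄.IsRep v₄ w₄) : cr₁ F₁ F₂ F₃ F₄ =
      -((w₁ ⬝ᵥ v₂ * det₃ v₁ v₃ v₄) / (w₁ ⬝ᵥ v₄ * det₃ v₁ v₃ v₂)) := by
  obtain ⟨a₁, b₁, ha₁, hb₁, h₁, h₁'⟩ := h₁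
  obtain ⟨a₂, b₂, ha₂, hb₂, h₂, h₂'⟩ := h₂
  obtain ⟨a₃, b₃, ha₃, hb₃, h₃, h₃'⟩ := h₃
  obtain ⟨a₄, b₄, ha₄, hb₄, h₄, h₄'⟩ := h₄
  have hk : b₁ * a₁ * a₂ * a₃ * a₄ ≠ 0 := by simp [*]
  change -(((F₁.line.rep ⬝ᵥ F₂.point.rep) * det₃ F₁.point.rep F₃.point.rep F₄.point.rep) /
    ((F₁.line.rep ⬝ᵥ F₄.point.rep) * det₃ F₁.point.rep F₃.point.rep F₂.point.rep)) = _
  simp only [h₁, h₁', h₂, h₃, h₄, det₃_smul, smul_dotProduct, dotProduct_smul, smul_eq_mul]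
  refine congrArg Neg.neg (Eq.trans ?_ (mul_div_mul_left _ _ hk))
  congr 1 <;> ring

theorem cr₂_eq (h₁ : F₁.IsRep v₁ w₁) (h₂ : F₂.IsRep v₂ w₂) (h₃ : F₃.IsRep v₃ w₃)
    (h₄ : F₄.IsRep v₄ w₄) : cr₂ F₁ F₂ F₃ F₄ =
      -((w₃ ⬝ᵥ v₄ * det₃ v₁ v₃ v₂) / (w₃ ⬝ᵥ v₂ * det₃ v₁ v₃ v₄)) := by
  obtain ⟨a₁, b₁, ha₁, hb₁, h₁, h₁'⟩ := h₁
  obtain ⟨a₂, b₂, ha₂, hb₂, h₂, h₂'⟩ := h₂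
  obtain ⟨a₃, b₃, ha₃, hb₃, h₃, h₃'⟩ := h₃
  obtain ⟨a₄, b₄, ha₄, hb₄, h₄, h₄'⟩ := h₄
  have hk : b₃ * a₁ * a₂ * a₃ * a₄ ≠ 0 := by simp [*]
  change -(((F₃.line.rep ⬝ᵥ F₄.point.rep) * det₃ F₁.point.rep F₃.point.rep F₂.point.rep) /
    ((F₃.line.rep ⬝ᵥ F₂.point.rep) * det₃ F₁.point.rep F₃.point.rep F₄.point.rep)) = _
  simp only [h₁, h₃', h₂, h₃, h₄, det₃_smul, smul_dotProduct, dotProduct_smul, smul_eq_mul]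
  refine congrArg Neg.neg (Eq.trans ?_ (mul_div_mul_left _ _ hk))
  congr 1 <;> ring

theorem tripleRatio_eq (h₁ : F₁.IsRep v₁ w₁) (h₂ : F₂.IsRep v₂ w₂) (h₃ : F₃.IsRep v₃ w₃) :
    tripleRatio F₁ F₂ F₃ = ((w₁ ⬝ᵥ v₂) * (w₂ ⬝ᵥ v₃) * (w₃ ⬝ᵥ v₁)) /
      ((w₁ ⬝ᵥ v₃) * (w₂ ⬝ᵥ v₁) * (w₃ ⬝ᵥ v₂)) := by
  obtain ⟨a₁, b₁, ha₁, hb₁, h₁, h₁'⟩ := h₁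
  obtain ⟨a₂, b₂, ha₂, hb₂, h₂, h₂'⟩ := h₂
  obtain ⟨a₃, b₃, ha₃, hb₃, h₃, h₃'⟩ := h₃
  have hk : b₁ * b₂ * b₃ * a₁ * a₂ * a₃ ≠ 0 := by simp [*]
  change ((F₁.line.rep ⬝ᵥ F₂.point.rep) * (F₂.line.rep ⬝ᵥ F₃.point.rep) *
    (F₃.line.rep ⬝ᵥ F₁.point.rep)) / ((F₁.line.rep ⬝ᵥ F₃.point.rep) *
    (F₂.line.rep ⬝ᵥ F₁.point.rep) * (F₃.line.rep ⬝ᵥ F₂.point.rep)) = _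
  simp only [h₁, h₁', h₂, h₂', h₃, h₃', smul_dotProduct, dotProduct_smul, smul_eq_mul]
  refine Eq.trans ?_ (mul_div_mul_left _ _ hk)
  congr 1 <;> ring

end Flag.IsRep

theorem exists_isRep {v w : Fin 3 → ℝ} (hv : v ≠ 0) (hw : w ≠ 0) (h : w ⬝ᵥ v = 0) :
    ∃ F : Flag, F.IsRep v w := by
  obtain ⟨a, ha⟩ := Projectivization.exists_smul_eq_mk_rep ℝ v hv
  obtain ⟨b, hb⟩ := Projectivization.exists_smul_eq_mk_rep ℝ w hw
  exact ⟨⟨.mk ℝ v hv, .mk ℝ w hw, (Projectivization.orthogonal_mk hw hv).2 h⟩, a, b, a.ne_zero,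
    b.ne_zero, ha.symm, hb.symm⟩

/-! ### Normal form of a triple of flags -/

/-- Every invertible matrix is a multiple of one in `SL(3, ℝ)`, because real cube roots exist. -/
theorem exists_smul_eq_coe {M : Matrix (Fin 3) (Fin 3) ℝ} (hM : M.det ≠ 0) :
    ∃ (g : PSL3) (c : ℝ), c ≠ 0 ∧ g.1 = c • M := by
  obtain ⟨r, hr⟩ : ∃ r : ℝ, r ^ 3 = M.det⁻¹ := by
    rcases le_total 0 M.det with h | h
    · exact ⟨M.det⁻¹ ^ (1 / 3 : ℝ), by
        rw [← Real.rpow_natCast, ← Real.rpow_mul (inv_nonneg.2 h)]; norm_num⟩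
    · refine ⟨-(-M.det⁻¹) ^ (1 / 3 : ℝ), ?_⟩
      rw [Odd.neg_pow (by decide), ← Real.rpow_natCast,
        ← Real.rpow_mul (neg_nonneg.2 (inv_nonpos.2 h))]
      norm_num
  refine ⟨⟨r • M, ?_⟩, r, ?_, rfl⟩
  · rw [Matrix.det_smul, Fintype.card_fin, hr, inv_mul_cancel₀ hM]
  · rintro rfl
    exact inv_ne_zero hM (by simpa using hr.symm)

/-- A transverse triple of flags with non-collinear points is determined by its triple ratio, up
to the projective group: in a suitable basis it has the displayed form. -/
theorem exists_smul_isRep_standard {F₁ F₂ F₃ : Flag} (h12 : F₁.Transverse F₂)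
    (h13 : F₁.Transverse F₃) (h23 : F₂.Transverse F₃)
    (hdet : det₃ F₁.point.rep F₂.point.rep F₃.point.rep ≠ 0) :
    ∃ g : PSL3, (g • F₁).IsRep ![1, 0, 0] ![0, 1, 1] ∧ (g • F₂).IsRep ![0, 1, 0] ![1, 0, 1] ∧
      (g • F₃).IsRep ![0, 0, 1] ![tripleRatio F₁ F₂ F₃, 1, 0] := by
  have r₁ := F₁.isRep_rep
  have r₂ := F₂.isRep_rep
  have r₃ := F₃.isRep_rep
  obtain ⟨n12, n21⟩ := (r₁.transverse_iff r₂).1 h12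
  obtain ⟨n13, n31⟩ := (r₁.transverse_iff r₃).1 h13
  obtain ⟨n23, n32⟩ := (r₂.transverse_iff r₃).1 h23
  have z1 := r₁.dotProduct_eq_zero
  have z2 := r₂.dotProduct_eq_zero
  have z3 := r₃.dotProduct_eq_zero
  rw [r₁.tripleRatio_eq r₂ r₃]
  generalize F₁.point.rep = v₁ at *
  generalize F₂.point.rep = v₂ at *
  generalize F₃.point.rep = v₃ at *
  generalize F₁.line.rep = w₁ at *
  generalize F₂.line.rep = w₂ at *
  generalize F₃.line.rep = w₃ at *
  -- The scalings of the basis vectors that bring the first two lines into the desired form.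
  set x₃ := (w₁ ⬝ᵥ v₂) / (w₁ ⬝ᵥ v₃) with hx₃
  set x₁ := x₃ * (w₂ ⬝ᵥ v₃) / (w₂ ⬝ᵥ v₁) with hx₁
  have hx₃0 : x₃ ≠ 0 := div_ne_zero n12 n13
  have hx₁0 : x₁ ≠ 0 := div_ne_zero (mul_ne_zero hx₃0 n23) n21
  set M : Matrix (Fin 3) (Fin 3) ℝ := (Matrix.of ![x₁ • v₁, v₂, x₃ • v₃])ᵀ with hM
  have hMdet : M.det ≠ 0 := by
    rw [hM, Matrix.det_transpose]
    have := det₃_smul x₁ 1 x₃ v₁ v₂ v₃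
    rw [one_smul, det₃] at this
    rw [this]
    simp [hx₁0, hx₃0, hdet]
  obtain ⟨g, c, hc, hg⟩ := exists_smul_eq_coe hMdet
  have hcol (t : Fin 3 → ℝ) : g.1 *ᵥ t = c • (t 0 • x₁ • v₁ + t 1 • v₂ + t 2 • x₃ • v₃) := by
    rw [hg, Matrix.smul_mulVec]
    congr 1
    ext i
    simp [hM, Matrix.mulVec, dotProduct, Fin.sum_univ_three, Matrix.transpose_apply]
    ring
  have hrow (w : Fin 3 → ℝ) : w ᵥ* g.1 =
      c • ![x₁ * (w ⬝ᵥ v₁), w ⬝ᵥ v₂, x₃ * (w ⬝ᵥ v₃)] := by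
    rw [hg, Matrix.vecMul_smul]
    congr 1
    ext i
    fin_cases i <;>
      simp [hM, Matrix.vecMul, dotProduct, Fin.sum_univ_three] <;> ring
  have hinv (t w : Fin 3 → ℝ) (a b : ℝ) (v u : Fin 3 → ℝ) (ha : a ≠ 0) (hb : b ≠ 0)
      (F : Flag) (hF : F.IsRep v w) (h1 : g.1 *ᵥ t = a • v) (h2 : w ᵥ* g.1 = b • u) :
      (g⁻¹ • F).IsRep t u := by
    have i1 : g.1 * (g⁻¹).1 = 1 := by
      rw [← Matrix.SpecialLinearGroup.coe_mul, mul_inv_cancel, Matrix.SpecialLinearGroup.coe_one]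
    have i2 : (g⁻¹).1 * g.1 = 1 := by
      rw [← Matrix.SpecialLinearGroup.coe_mul, inv_mul_cancel, Matrix.SpecialLinearGroup.coe_one]
    refine hF.smul g⁻¹ (c := a⁻¹) (d := b⁻¹) ?_ ?_ (inv_ne_zero hb)
    · have : v = a⁻¹ • (g.1 *ᵥ t) := by rw [h1, smul_smul, inv_mul_cancel₀ ha, one_smul]
      rw [this, Matrix.mulVec_smul, Matrix.mulVec_mulVec, i2, Matrix.one_mulVec]
    · have : u = b⁻¹ • (w ᵥ* g.1) := by rw [h2, smul_smul, inv_mul_cancel₀ hb, one_smul]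
      rw [this, Matrix.smul_vecMul, Matrix.vecMul_vecMul, i1, Matrix.vecMul_one]
  refine ⟨g⁻¹, ?_, ?_, ?_⟩
  · refine hinv _ w₁ (c * x₁) (c * (w₁ ⬝ᵥ v₂)) v₁ _ (mul_ne_zero hc hx₁0) (mul_ne_zero hc n12) F₁
      r₁ ?_ ?_
    · rw [hcol]; simp [smul_smul]
    · rw [hrow, mul_smul]
      congr 1
      ext i
      fin_cases i <;> simp [z1, hx₃]
      field_simp
  · refine hinv _ w₂ c (c * (x₁ * (w₂ ⬝ᵥ v₁))) v₂ _ hc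
      (mul_ne_zero hc (mul_ne_zero hx₁0 n21)) F₂ r₂ ?_ ?_
    · rw [hcol]; simp
    · rw [hrow, mul_smul]
      congr 1
      ext i
      fin_cases i <;> simp [z2, hx₁]
      field_simp
  · refine hinv _ w₃ (c * x₃) (c * (w₃ ⬝ᵥ v₂)) v₃ _ (mul_ne_zero hc hx₃0) (mul_ne_zero hc n32) F₃
      r₃ ?_ ?_
    · rw [hcol]; simp [smul_smul]
    · rw [hrow, mul_smul]
      congr 1
      ext i
      fin_cases i <;> simp [z3, hx₁, hx₃]
      field_simp

/-- An element of `PSL(3, ℝ)` that fixes three flags in general position is trivial. -/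
theorem eq_one_of_smul_eq {F₁ F₂ F₃ : Flag} (h12 : F₁.Transverse F₂) (h13 : F₁.Transverse F₃)
    (h23 : F₂.Transverse F₃) (hdet : det₃ F₁.point.rep F₂.point.rep F₃.point.rep ≠ 0) {g : PSL3}
    (h1 : g • F₁ = F₁) (h2 : g • F₂ = F₂) (h3 : g • F₃ = F₃) : g = 1 := by
  obtain ⟨k, k1, k2, k3⟩ := exists_smul_isRep_standard h12 h13 h23 hdet
  suffices H : ∀ (g : PSL3) (G₁ G₂ G₃ : Flag), G₁.IsRep ![1, 0, 0] ![0, 1, 1] →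
      G₂.IsRep ![0, 1, 0] ![1, 0, 1] → G₃.IsRep ![0, 0, 1] ![tripleRatio F₁ F₂ F₃, 1, 0] →
      g • G₁ = G₁ → g • G₂ = G₂ → g • G₃ = G₃ → g = 1 by
    have e (F : Flag) (hF : g • F = F) : (k * g * k⁻¹) • k • F = k • F := by
      rw [smul_smul, inv_mul_cancel_right, mul_smul, hF]
    have := H (k * g * k⁻¹) _ _ _ k1 k2 k3 (e _ h1) (e _ h2) (e _ h3)
    rwa [conj_eq_one_iff] at this
  intro g G₁ G₂ G₃ r₁ r₂ r₃ e₁ e₂ e₃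
  have key {G : Flag} {v w : Fin 3 → ℝ} (hG : G.IsRep v w) (e : g • G = G) :
      (∃ c : ℝ, g.1 *ᵥ v = c • v) ∧ ∃ d : ℝ, w ᵥ* g.1 = d • w := by
    obtain ⟨a, b, ha, hb, h, h'⟩ := hG
    obtain ⟨a₁, ha₁, k⟩ := exists_rep_smul g G.point
    obtain ⟨b₁, hb₁, k'⟩ := exists_rep_smul (g⁻¹).transpose G.line
    have ep : g • G.point = G.point := congrArg Flag.point e
    have el : (g⁻¹).transpose • G.line = G.line := congrArg Flag.line e
    constructor
    · rw [ep, h, Matrix.mulVec_smul, smul_comm] at k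
      have k := smul_right_injective _ ha k
      exact ⟨a₁⁻¹, by rw [← smul_right_injective _ ha₁ |>.eq_iff]; simp [← k, smul_smul, ha₁]⟩
    · have h2 : (g⁻¹).transpose.1 = ((g⁻¹).1)ᵀ := rfl
      have i2 : (g⁻¹).1 * g.1 = 1 := by
        rw [← Matrix.SpecialLinearGroup.coe_mul, inv_mul_cancel,
          Matrix.SpecialLinearGroup.coe_one]
      rw [el, h', Matrix.mulVec_smul, smul_comm, h2, Matrix.mulVec_transpose] at k'
      have k' := smul_right_injective _ hb k'
      refine ⟨b₁, ?_⟩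
      conv_lhs => rw [k']
      simp only [Matrix.smul_vecMul, Matrix.vecMul_vecMul, i2, Matrix.vecMul_one]
  obtain ⟨⟨a₁, p₁⟩, b₁, l₁⟩ := key r₁ e₁
  obtain ⟨⟨a₂, p₂⟩, b₂, l₂⟩ := key r₂ e₂
  obtain ⟨⟨a₃, p₃⟩, -⟩ := key r₃ e₃
  have hd := g.2
  rw [funext_iff, Fin.forall_fin_succ, Fin.forall_fin_two] at p₁ p₂ p₃ l₁ l₂
  simp [Matrix.mulVec, Matrix.vecMul, dotProduct, Fin.sum_univ_three] at p₁ p₂ p₃ l₁ l₂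
  obtain ⟨-, p10, p20⟩ := p₁
  obtain ⟨p01, -, p21⟩ := p₂
  obtain ⟨p02, p12, -⟩ := p₃
  simp only [p10, p20, p01, p21, p02, p12, add_zero, zero_add] at l₁ l₂
  rw [Matrix.det_fin_three] at hd
  simp only [p10, p20, p01, p21, p02, p12, mul_zero, sub_zero, add_zero, zero_mul] at hd
  have e11 : g.1 1 1 = g.1 0 0 := by rw [l₁.2.1, ← l₁.2.2, l₂.2.2, ← l₂.1]
  have e22 : g.1 2 2 = g.1 0 0 := by rw [l₂.2.2, ← l₂.1]
  have e00 : g.1 0 0 = 1 := by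
    rw [e11, e22] at hd
    have : g.1 0 0 ^ 3 = 1 := by linear_combination hd
    exact (Odd.strictMono_pow (n := 3) (by decide)).injective (by simpa using this)
  apply Subtype.ext
  ext i j
  rw [Matrix.SpecialLinearGroup.coe_one]
  fin_cases i <;> fin_cases j <;> simp [p10, p20, p01, p21, p02, p12, e11, e22, e00]

/-! ### Normal form of a positive framed representation -/

/-- The normal form of a positive framed representation with coordinates `y`: the points of the
first triangle are the basis vectors, their lines are standard up to the entry `τ₁ = y 6`, and the
flags at the neighbouring vertices have the representatives that the remaining coordinates force.
Vectors are scaled so that no denominators appear. -/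
structure FramedRep.IsNormal (R : FramedRep) (y : Fin 8 → ℝ) : Prop where
  rα : R.Fα.IsRep ![1, 0, 0] ![0, 1, 1]
  rγ : R.Fγ.IsRep ![0, 1, 0] ![1, 0, 1]
  rβ : R.Fβ.IsRep ![0, 0, 1] ![y 6, 1, 0]
  sβ : R.Gβ.IsRep ![1 + y 0, y 0 * (1 + y 1), -y 0]
    ![y 0 * y 1, y 7, y 1 * (1 + y 0) + y 7 * (1 + y 1)]
  sγ : R.Gγ.IsRep ![y 2 * (1 + y 3), -(y 6 * y 2), y 6 * (1 + y 2)]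
    ![y 6 * y 7, y 7 * (1 + y 3) + y 3 * (1 + y 2), y 2 * y 3]
  sα : R.Gα.IsRep ![-y 4, y 6 * (1 + y 4), y 4 * (1 + y 5)]
    ![y 5 * y 6 * (1 + y 4) + y 6 * y 7 * (1 + y 5), y 4 * y 5, y 6 * y 7]

theorem eq_vec_three (v : Fin 3 → ℝ) : v = ![v 0, v 1, v 2] := by
  ext i; fin_cases i <;> rfl

section FourthFlag

variable {Fα Fβ Fγ G : Flag} {τ : ℝ}

/-- The flag across the edge `v_α v_γ` is determined by the coordinates. -/
theorem isRep_of_cr_αγ (rα : Fα.IsRep ![1, 0, 0] ![0, 1, 1]) (rγ : Fγ.IsRep ![0, 1, 0] ![1, 0, 1])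
    (rβ : Fβ.IsRep ![0, 0, 1] ![τ, 1, 0]) {a b c : ℝ} (ha : cr₂ Fα G Fγ Fβ = a)
    (hb : cr₁ Fα G Fγ Fβ = b) (hc : tripleRatio Fα G Fγ = c) (pa : 0 < a) (pb : 0 < b)
    (pc : 0 < c) :
    G.IsRep ![1 + a, a * (1 + b), -a] ![a * b, c, b * (1 + a) + c * (1 + b)] := by
  have r := G.isRep_rep
  have z := r.dotProduct_eq_zero
  rw [rα.cr₂_eq r rγ rβ] at ha
  rw [rα.cr₁_eq r rγ rβ] at hb
  rw [rα.tripleRatio_eq r rγ] at hc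
  generalize G.point.rep = v at *
  generalize G.line.rep = w at *
  rw [eq_vec_three v, eq_vec_three w] at *
  generalize v 0 = x at *
  generalize v 1 = x' at *
  generalize v 2 = x'' at *
  generalize w 0 = l at *
  generalize w 1 = l' at *
  generalize w 2 = l'' at *
  simp [det₃, Matrix.det_fin_three, dotProduct, Fin.sum_univ_three] at ha hb hc z
  have n1 : x + x'' ≠ 0 := by rintro h; simp [h] at ha; exact pa.ne ha
  have n2 : x'' ≠ 0 := by rintro h; simp [h] at hb; exact pb.ne hb
  have n3 : x' + x'' ≠ 0 := by rintro h; simp [h] at hb; exact pb.ne hb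
  have n4 : l ≠ 0 := by rintro h; simp [h] at hc; exact pc.ne hc
  have e1 : x = -(x'' / a) * (1 + a) := by rw [← ha]; field_simp; ring
  have e2 : x' = -(x'' / a) * (a * (1 + b)) := by
    have : x' = -x'' * (1 + b) := by rw [← hb]; field_simp; ring
    rw [this]; field_simp
  have e3 : l' = l / (a * b) * c := by
    rw [← hc, ← ha, ← hb]; field_simp
  refine r.smul_right (a := -(x'' / a)) (b := l / (a * b)) ?_ ?_
  · ext i
    fin_cases i
    · simpa using e1
    · simpa using e2
    · simp; field_simp
  · ext i
    fin_cases i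
    · simp; field_simp
    · simpa using e3
    · simp
      have : l'' * x'' = -(l * x + l' * x') := by linear_combination z
      have : l'' = -(l * x + l' * x') / x'' := by rw [← this]; field_simp
      rw [this, e1, e2, e3]; field_simp; ring

/-- The flag across the edge `v_α v_β` is determined by the coordinates. -/
theorem isRep_of_cr_αβ (rα : Fα.IsRep ![1, 0, 0] ![0, 1, 1]) (rγ : Fγ.IsRep ![0, 1, 0] ![1, 0, 1])
    (rβ : Fβ.IsRep ![0, 0, 1] ![τ, 1, 0]) {a b c : ℝ} (ha : cr₁ Fα Fγ Fβ G = a)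
    (hb : cr₂ Fα Fγ Fβ G = b) (hc : tripleRatio Fα G Fβ = c⁻¹) (pt : 0 < τ) (pa : 0 < a)
    (pb : 0 < b) (pc : 0 < c) :
    G.IsRep ![a * (1 + b), -(τ * a), τ * (1 + a)] ![τ * c, c * (1 + b) + b * (1 + a), a * b] := by
  have r := G.isRep_rep
  have z := r.dotProduct_eq_zero
  rw [rα.cr₁_eq rγ rβ r] at ha
  rw [rα.cr₂_eq rγ rβ r] at hb
  rw [rα.tripleRatio_eq r rβ] at hc
  generalize G.point.rep = v at *
  generalize G.line.rep = w at *
  rw [eq_vec_three v, eq_vec_three w] at *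
  generalize v 0 = x at *
  generalize v 1 = x' at *
  generalize v 2 = x'' at *
  generalize w 0 = l at *
  generalize w 1 = l' at *
  generalize w 2 = l'' at *
  simp [det₃, Matrix.det_fin_three, dotProduct, Fin.sum_univ_three] at ha hb hc z
  have n1 : x' + x'' ≠ 0 := by
    intro h
    rw [show -x'' + -x' = 0 by linear_combination -h] at ha
    simp at ha
    exact pa.ne ha
  have n2 : x' ≠ 0 := by rintro h; simp [h] at hb; exact pb.ne hb
  have n3 : τ * x + x' ≠ 0 := by
    intro h
    rw [show -x' + -(τ * x) = 0 by linear_combination -h] at hb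
    simp at hb
    exact pb.ne hb
  have n4 : l ≠ 0 := by rintro h; simp [h] at hc; exact pc.ne hc
  have ha' : a * (x' + x'') = -x' := by
    have : -x'' + -x' = -(x' + x'') := by ring
    rw [← ha, this]; field_simp
  have hb' : b * x' = -(x' + τ * x) := by
    rw [← hb]; field_simp; ring
  have hc' : c * ((x' + x'') * l'' * τ) = l * (τ * x + x') := by
    rw [div_eq_iff (mul_ne_zero n4 n3)] at hc
    rw [hc, mul_inv_cancel_left₀ pc.ne']
  have e1 : x = -(x' / (τ * a)) * (a * (1 + b)) := by
    field_simp; linear_combination hb'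
  have e2 : x'' = -(x' / (τ * a)) * (τ * (1 + a)) := by
    field_simp; linear_combination ha'
  have e3 : l'' = l / (τ * c) * (a * b) := by
    field_simp
    refine mul_right_cancel₀ n1 ?_
    linear_combination hc' - l * b * ha' + l * hb'
  refine r.smul_right (a := -(x' / (τ * a))) (b := l / (τ * c)) ?_ ?_
  · ext i
    fin_cases i
    · simpa using e1
    · simp; field_simp
    · simpa using e2
  · ext i
    fin_cases i
    · simp; field_simp
    · simp
      have : l' * x' = -(l * x + l'' * x'') := by linear_combination z
      have : l' = -(l * x + l'' * x'') / x' := by rw [← this]; field_simp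
      rw [this, e1, e2, e3]; field_simp; ring
    · simpa using e3

/-- The flag across the edge `v_γ v_β` is determined by the coordinates. -/
theorem isRep_of_cr_γβ (rα : Fα.IsRep ![1, 0, 0] ![0, 1, 1]) (rγ : Fγ.IsRep ![0, 1, 0] ![1, 0, 1])
    (rβ : Fβ.IsRep ![0, 0, 1] ![τ, 1, 0]) {a b c : ℝ} (ha : cr₂ Fγ G Fβ Fα = a)
    (hb : cr₁ Fγ G Fβ Fα = b) (hc : tripleRatio Fγ G Fβ = c) (pt : 0 < τ) (pa : 0 < a)
    (pb : 0 < b) (pc : 0 < c) :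
    G.IsRep ![-a, τ * (1 + a), a * (1 + b)] ![b * τ * (1 + a) + τ * c * (1 + b), a * b, τ * c] := by
  have r := G.isRep_rep
  have z := r.dotProduct_eq_zero
  rw [rγ.cr₂_eq r rβ rα] at ha
  rw [rγ.cr₁_eq r rβ rα] at hb
  rw [rγ.tripleRatio_eq r rβ] at hc
  generalize G.point.rep = v at *
  generalize G.line.rep = w at *
  rw [eq_vec_three v, eq_vec_three w] at *
  generalize v 0 = x at *
  generalize v 1 = x' at *
  generalize v 2 = x'' at *
  generalize w 0 = l at *
  generalize w 1 = l' at *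
  generalize w 2 = l'' at *
  simp [det₃, Matrix.det_fin_three, dotProduct, Fin.sum_univ_three] at ha hb hc z
  have n1 : x + x'' ≠ 0 := by rintro h; simp [h] at hb; exact pb.ne hb
  have n2 : x ≠ 0 := by rintro h; simp [h] at ha; exact pa.ne ha
  have n3 : τ * x + x' ≠ 0 := by rintro h; simp [h] at ha; exact pa.ne ha
  have n4 : l' ≠ 0 := by rintro h; simp [h] at hc; exact pc.ne hc
  have ha' : a * (τ * x + x') = -(τ * x) := by
    rw [← ha]; field_simp
  have e1 : x' = -(x / a) * (τ * (1 + a)) := by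
    field_simp; linear_combination ha'
  have e2 : x'' = -(x / a) * (a * (1 + b)) := by
    rw [← hb]; field_simp; ring
  have e3 : l'' = l' / (a * b) * (τ * c) := by
    rw [← hc, ← ha, ← hb]; field_simp
  refine r.smul_right (a := -(x / a)) (b := l' / (a * b)) ?_ ?_
  · ext i
    fin_cases i
    · simp; field_simp
    · simpa using e1
    · simpa using e2
  · ext i
    fin_cases i
    · simp
      have : l * x = -(l' * x' + l'' * x'') := by linear_combination z
      have : l = -(l' * x' + l'' * x'') / x := by rw [← this]; field_simp
      rw [this, e1, e2, e3]; field_simp; ring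
    · simp; field_simp
    · simpa using e3

end FourthFlag

theorem tripleRatio_swap (F₁ F₂ F₃ : Flag) : tripleRatio F₁ F₃ F₂ = (tripleRatio F₁ F₂ F₃)⁻¹ := by
  rw [tripleRatio, tripleRatio, inv_div]
  congr 1 <;> ring

theorem tripleRatio_rotate (F₁ F₂ F₃ : Flag) : tripleRatio F₂ F₃ F₁ = tripleRatio F₁ F₂ F₃ := by
  rw [tripleRatio, tripleRatio]
  congr 1 <;> ring

namespace FramedRep

variable (R : FramedRep)

theorem loop_mul : loop .α * loop .β * loop .γ = 1 :=
  PresentedGroup.one_of_mem (Set.mem_singleton _)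

theorem rho_mul : R.rho (loop .α) * R.rho (loop .β) * R.rho (loop .γ) = 1 := by
  rw [← map_mul, ← map_mul, loop_mul, map_one]

theorem rho_β : R.rho (loop .β) = (R.rho (loop .α))⁻¹ * (R.rho (loop .γ))⁻¹ := by
  have := R.rho_mul
  rw [eq_inv_mul_iff_mul_eq, eq_inv_iff_mul_eq_one, this]

theorem inv_smul_flag (c : Peripheral) : (R.rho (loop c))⁻¹ • R.flag c = R.flag c := by
  rw [inv_smul_eq_iff, R.fixed]

theorem α_smul_Fα : R.rho (loop .α) • R.Fα = R.Fα := R.fixed .α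

theorem γ_smul_Fγ : R.rho (loop .γ) • R.Fγ = R.Fγ := R.fixed .γ

theorem α_smul_Fβ : R.rho (loop .α) • R.Fβ = R.Gβ := rfl

theorem γ_smul_Fα : R.rho (loop .γ) • R.Fα = R.Gα := rfl

theorem α_smul_Gγ : R.rho (loop .α) • R.Gγ = R.Fγ := by
  rw [Gγ, rho_β, smul_smul, mul_inv_cancel_left]
  exact R.inv_smul_flag .γ

theorem γ_smul_Gβ : R.rho (loop .γ) • R.Gβ = R.Fβ := by
  have h : R.rho (loop .γ) * R.rho (loop .α) = (R.rho (loop .β))⁻¹ := by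
    rw [rho_β]; group
  rw [Gβ, smul_smul, h]
  exact R.inv_smul_flag .β

theorem coords_zero : R.coords 0 = cr₂ R.Fα R.Gβ R.Fγ R.Fβ := rfl

theorem coords_one : R.coords 1 = cr₁ R.Fα R.Gβ R.Fγ R.Fβ := rfl

theorem coords_two : R.coords 2 = cr₁ R.Fα R.Fγ R.Fβ R.Gγ := rfl

theorem coords_three : R.coords 3 = cr₂ R.Fα R.Fγ R.Fβ R.Gγ := rfl

theorem coords_four : R.coords 4 = cr₂ R.Fγ R.Gα R.Fβ R.Fα := rfl

theorem coords_five : R.coords 5 = cr₁ R.Fγ R.Gα R.Fβ R.Fα := rfl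

theorem coords_seven : R.coords 7 = tripleRatio R.Fα R.Gβ R.Fγ := rfl

variable {R}

/-- The triple ratio of the triangle across `v_α v_β`. It is a lift of the second triangle with the
opposite orientation of the chosen triple, whence the inverse. -/
theorem tripleRatio_αβ : tripleRatio R.Fα R.Gγ R.Fβ = (R.coords 7)⁻¹ := by
  rw [coords_seven]
  rw [← tripleRatio_smul (R.rho (loop .α)), α_smul_Fα, α_smul_Gγ, α_smul_Fβ, tripleRatio_swap]

theorem tripleRatio_γβ : tripleRatio R.Fγ R.Gα R.Fβ = R.coords 7 := by
  rw [coords_seven, tripleRatio_rotate R.Fγ R.Fα R.Gβ,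
    ← tripleRatio_smul (R.rho (loop .γ)) R.Fγ R.Fα R.Gβ, γ_smul_Fγ, γ_smul_Fα, γ_smul_Gβ]

/-- Positivity implies that the three points of the first triangle are not collinear. -/
theorem IsPositive.det₃_ne_zero (h : R.IsPositive) :
    det₃ R.Fα.point.rep R.Fγ.point.rep R.Fβ.point.rep ≠ 0 := by
  intro h0
  have h1 : 0 < cr₁ R.Fα R.Gβ R.Fγ R.Fβ := h.2.2.2 1
  have h2 : lineThrough R.Fα.point R.Fγ.point R.Fβ.point = 0 := h0
  simp [cr₁, h2] at h1

theorem IsPositive.exists_isNormal (h : R.IsPositive) :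
    ∃ g : PSL3, (g • R).IsNormal R.coords := by
  obtain ⟨g, gα, gγ, gβ⟩ := exists_smul_isRep_standard h.1.2.1 h.1.2.2.1 h.1.2.2.2.2.2
    h.det₃_ne_zero
  have e : (g • R).coords = R.coords := R.coords_smul g
  have gα' : (g • R).Fα.IsRep ![1, 0, 0] ![0, 1, 1] := gα
  have gγ' : (g • R).Fγ.IsRep ![0, 1, 0] ![1, 0, 1] := gγ
  have gβ' : (g • R).Fβ.IsRep ![0, 0, 1] ![R.coords 6, 1, 0] := gβ
  have hp := h.2.2.2
  refine ⟨g, gα', gγ', gβ', ?_, ?_, ?_⟩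
  · exact isRep_of_cr_αγ gα' gγ' gβ' (by rw [← coords_zero, e]) (by rw [← coords_one, e])
      (by rw [← coords_seven, e]) (hp 0) (hp 1) (hp 7)
  · exact isRep_of_cr_αβ gα' gγ' gβ' (by rw [← coords_two, e]) (by rw [← coords_three, e])
      (by rw [tripleRatio_αβ, e]) (hp 6) (hp 2) (hp 3) (hp 7)
  · exact isRep_of_cr_γβ gα' gγ' gβ' (by rw [← coords_four, e]) (by rw [← coords_five, e])
      (by rw [tripleRatio_γβ, e]) (hp 6) (hp 4) (hp 5) (hp 7)

variable {y : Fin 8 → ℝ}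

theorem IsNormal.isPositive (h : R.IsNormal y) (hy : ∀ i, 0 < y i) :
    R.IsPositive ∧ R.coords = y := by
  obtain ⟨rα, rγ, rβ, sβ, sγ, sα⟩ := h
  have h0 := hy 0
  have h1 := hy 1
  have h2 := hy 2
  have h3 := hy 3
  have h4 := hy 4
  have h5 := hy 5
  have h6 := hy 6
  have h7 := hy 7
  have hc : R.coords = y := by
    ext i
    fin_cases i
    · change cr₂ R.Fα R.Gβ R.Fγ R.Fβ = y 0
      rw [rα.cr₂_eq sβ rγ rβ]
      simp [det₃, Matrix.det_fin_three, dotProduct, Fin.sum_univ_three]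
    · change cr₁ R.Fα R.Gβ R.Fγ R.Fβ = y 1
      rw [rα.cr₁_eq sβ rγ rβ]
      simp [det₃, Matrix.det_fin_three, dotProduct, Fin.sum_univ_three]
      field_simp
      ring
    · change cr₁ R.Fα R.Fγ R.Fβ R.Gγ = y 2
      rw [rα.cr₁_eq rγ rβ sγ]
      simp [det₃, Matrix.det_fin_three, dotProduct, Fin.sum_univ_three]
      field_simp
      ring
    · change cr₂ R.Fα R.Fγ R.Fβ R.Gγ = y 3
      rw [rα.cr₂_eq rγ rβ sγ]
      simp [det₃, Matrix.det_fin_three, dotProduct, Fin.sum_univ_three]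
      field_simp
      ring
    · change cr₂ R.Fγ R.Gα R.Fβ R.Fα = y 4
      rw [rγ.cr₂_eq sα rβ rα]
      simp [det₃, Matrix.det_fin_three, dotProduct, Fin.sum_univ_three]
      field_simp
      ring
    · change cr₁ R.Fγ R.Gα R.Fβ R.Fα = y 5
      rw [rγ.cr₁_eq sα rβ rα]
      simp [det₃, Matrix.det_fin_three, dotProduct, Fin.sum_univ_three]
      field_simp
      ring
    · change tripleRatio R.Fα R.Fγ R.Fβ = y 6
      rw [rα.tripleRatio_eq rγ rβ]
      simp [dotProduct, Fin.sum_univ_three]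
    · change tripleRatio R.Fα R.Gβ R.Fγ = y 7
      rw [rα.tripleRatio_eq sβ rγ]
      simp [dotProduct, Fin.sum_univ_three]
      field_simp
      ring
  refine ⟨⟨?_, ?_, ?_, hc ▸ hy⟩, hc⟩
  all_goals
    simp only [TransverseQuadruple, rα.transverse_iff sβ, rα.transverse_iff rγ,
      rα.transverse_iff rβ, sβ.transverse_iff rγ, sβ.transverse_iff rβ, rγ.transverse_iff rβ,
      rα.transverse_iff sγ, rγ.transverse_iff sγ, rβ.transverse_iff sγ, rγ.transverse_iff sα,
      sα.transverse_iff rβ, sα.transverse_iff rα, rγ.transverse_iff rα, rβ.transverse_iff rα]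
    simp only [dotProduct, Fin.sum_univ_three, Matrix.cons_val]
    ring_nf
    refine ⟨⟨?_, ?_⟩, ⟨?_, ?_⟩, ⟨?_, ?_⟩, ⟨?_, ?_⟩, ⟨?_, ?_⟩, ?_, ?_⟩ <;> positivity

theorem IsNormal.eq {R' : FramedRep} (h : R.IsNormal y) (h' : R'.IsNormal y) (hy : ∀ i, 0 < y i) :
    R = R' := by
  have hp := (h.isPositive hy).1
  have eα : R.Fα = R'.Fα := h.rα.eq h'.rα
  have eβ : R.Fβ = R'.Fβ := h.rβ.eq h'.rβ
  have eγ : R.Fγ = R'.Fγ := h.rγ.eq h'.rγ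
  have fβ : R.Gβ = R'.Gβ := h.sβ.eq h'.sβ
  have fγ : R.Gγ = R'.Gγ := h.sγ.eq h'.sγ
  have fα : R.Gα = R'.Gα := h.sα.eq h'.sα
  -- Two images of a generator that agree on a triple of flags differ by an element fixing them.
  have key {F₁ F₂ F₃ : Flag} {v₁ w₁ v₂ w₂ v₃ w₃ : Fin 3 → ℝ} (r₁ : F₁.IsRep v₁ w₁)
      (r₂ : F₂.IsRep v₂ w₂) (r₃ : F₃.IsRep v₃ w₃) (hd : det₃ v₁ v₂ v₃ ≠ 0)
      (t12 : F₁.Transverse F₂) (t13 : F₁.Transverse F₃) (t23 : F₂.Transverse F₃) (c : Peripheral)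
      (e₁ : R.rho (loop c) • F₁ = R'.rho (loop c) • F₁)
      (e₂ : R.rho (loop c) • F₂ = R'.rho (loop c) • F₂)
      (e₃ : R.rho (loop c) • F₃ = R'.rho (loop c) • F₃) : R.rho (loop c) = R'.rho (loop c) := by
    have hd' : det₃ F₁.point.rep F₂.point.rep F₃.point.rep ≠ 0 := by
      obtain ⟨a₁, _, ha₁, _, k₁, _⟩ := r₁
      obtain ⟨a₂, _, ha₂, _, k₂, _⟩ := r₂
      obtain ⟨a₃, _, ha₃, _, k₃, _⟩ := r₃
      rw [k₁, k₂, k₃, det₃_smul]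
      simp [*]
    have := eq_one_of_smul_eq t12 t13 t23 hd' (g := (R'.rho (loop c))⁻¹ * R.rho (loop c))
      (by rw [mul_smul, inv_smul_eq_iff, e₁]) (by rw [mul_smul, inv_smul_eq_iff, e₂])
      (by rw [mul_smul, inv_smul_eq_iff, e₃])
    rw [inv_mul_eq_one] at this
    exact this.symm
  have ρα : R.rho (loop .α) = R'.rho (loop .α) := by
    refine key h.rα h.rβ h.sγ ?_ hp.2.1.2.1 hp.2.1.2.2.1 hp.2.1.2.2.2.2.2 .α ?_ ?_ ?_
    · simp [det₃, Matrix.det_fin_three, (hy 6).ne', (hy 2).ne']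
    · rw [α_smul_Fα, eα, α_smul_Fα]
    · rw [α_smul_Fβ, eβ, α_smul_Fβ, fβ]
    · rw [α_smul_Gγ, fγ, α_smul_Gγ, eγ]
  have ργ : R.rho (loop .γ) = R'.rho (loop .γ) := by
    refine key h.rα h.sβ h.rγ ?_ hp.1.1 hp.1.2.1 hp.1.2.2.2.1 .γ ?_ ?_ ?_
    · simp [det₃, Matrix.det_fin_three, (hy 0).ne']
    · rw [γ_smul_Fα, eα, γ_smul_Fα, fα]
    · rw [γ_smul_Gβ, fβ, γ_smul_Gβ, eβ]
    · rw [γ_smul_Fγ, eγ, γ_smul_Fγ]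
  refine FramedRep.ext ?_ ?_
  · refine PresentedGroup.ext fun c => ?_
    cases c
    · exact ρα
    · change R.rho (loop .β) = R'.rho (loop .β)
      rw [rho_β, rho_β, ρα, ργ]
    · exact ργ
  · funext c
    cases c
    · exact eα
    · exact eβ
    · exact eγ

end FramedRep

/-! ### Framed representations with given coordinates -/

/-- The image of `α` in the normal form with coordinates `y`, up to normalisation of the
determinant. -/
def holα (y : Fin 8 → ℝ) : Matrix (Fin 3) (Fin 3) ℝ :=
  !![y 6 * y 7, y 7 * (1 + y 3) + y 3 * (1 + y 2) * (1 + y 0), y 2 * y 3 * (1 + y 0);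
     0, y 0 * y 3 * (1 + y 2 + y 1 * y 2), y 0 * y 2 * y 3 * (1 + y 1);
     0, -(y 0 * y 3 * (1 + y 2)), -(y 0 * y 2 * y 3)]

/-- The image of `γ⁻¹` in the normal form with coordinates `y`, up to normalisation of the
determinant. -/
def holγinv (y : Fin 8 → ℝ) : Matrix (Fin 3) (Fin 3) ℝ :=
  !![y 6 * y 7 * (1 + y 0 + y 0 * y 5), 0, y 6 * y 7 * (1 + y 0);
     y 0 * y 6 * (y 1 * y 5 * (1 + y 4) + y 7 * (1 + y 5) * (1 + y 1)),
       y 0 * y 1 * y 4 * y 5, y 0 * y 6 * y 7 * (1 + y 1);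
     -(y 0 * y 6 * y 7 * (1 + y 5)), 0, -(y 0 * y 6 * y 7)]

theorem det_holα (y : Fin 8 → ℝ) :
    (holα y).det = y 0 ^ 2 * y 1 * y 2 * y 3 ^ 2 * y 6 * y 7 := by
  simp [holα, Matrix.det_fin_three]
  ring

theorem det_holγinv (y : Fin 8 → ℝ) :
    (holγinv y).det = y 0 ^ 2 * y 1 * y 4 * y 5 ^ 2 * y 6 ^ 2 * y 7 ^ 2 := by
  simp [holγinv, Matrix.det_fin_three]
  ring

/-- The trace of the figure eight curve as a function of the Fock-Goncharov coordinates. -/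
noncomputable def traceForm (y : Fin 8 → ℝ) : ℝ :=
  (y 0 ^ 4 * y 1 ^ 2 * y 2 * y 3 ^ 2 * y 4 * y 5 ^ 2 * y 6 ^ 3 * y 7 ^ 3) ^ (-1 / 3 : ℝ) *
    (y 6 ^ 2 * y 7 ^ 2 * (1 + y 0 + y 0 * y 5) +
      y 0 * y 6 * y 7 * (1 + y 3) * (y 1 * y 5 * (1 + y 4) + y 7 * (1 + y 5) * (1 + y 1)) +
      y 0 * y 1 * y 3 * y 5 * y 6 * (1 + y 2) * (1 + y 0) * (1 + y 4) +
      y 0 * y 3 * y 6 * y 7 * (1 + y 1 + y 1 * y 2) * (1 + y 5 + y 0 * y 5) +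
      y 0 ^ 2 * y 1 * y 3 * y 4 * y 5 * (1 + y 2 + y 1 * y 2))

theorem trace_holα_mul_holγinv (y : Fin 8 → ℝ) : Matrix.trace (holα y * holγinv y) =
    y 6 ^ 2 * y 7 ^ 2 * (1 + y 0 + y 0 * y 5) +
      y 0 * y 6 * y 7 * (1 + y 3) * (y 1 * y 5 * (1 + y 4) + y 7 * (1 + y 5) * (1 + y 1)) +
      y 0 * y 1 * y 3 * y 5 * y 6 * (1 + y 2) * (1 + y 0) * (1 + y 4) +
      y 0 * y 3 * y 6 * y 7 * (1 + y 1 + y 1 * y 2) * (1 + y 5 + y 0 * y 5) +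
      y 0 ^ 2 * y 1 * y 3 * y 4 * y 5 * (1 + y 2 + y 1 * y 2) := by
  simp [holα, holγinv, Matrix.trace_fin_three]
  ring

/-- The matrix of determinant one that is a positive multiple of `M`. -/
noncomputable def normalize (M : Matrix (Fin 3) (Fin 3) ℝ) (h : 0 < M.det) : PSL3 :=
  ⟨M.det ^ (-1 / 3 : ℝ) • M, by
    rw [Matrix.det_smul, Fintype.card_fin, ← Real.rpow_natCast, ← Real.rpow_mul h.le]
    norm_num
    rw [Real.rpow_neg_one, inv_mul_cancel₀ h.ne']⟩

theorem Flag.IsRep.normalize_smul {F : Flag} {v w v' w' : Fin 3 → ℝ} (hF : F.IsRep v w)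
    {M : Matrix (Fin 3) (Fin 3) ℝ} (h : 0 < M.det) {c d : ℝ} (hv : M *ᵥ v = c • v')
    (hw : w' ᵥ* M = d • w) (hd : d ≠ 0) : (normalize M h • F).IsRep v' w' := by
  refine hF.smul (normalize M h) (c := M.det ^ (-1 / 3 : ℝ) * c) (d := M.det ^ (-1 / 3 : ℝ) * d)
    ?_ ?_ (mul_ne_zero (Real.rpow_pos_of_pos h _).ne' hd)
  · rw [normalize, Matrix.smul_mulVec, hv, smul_smul]
  · rw [normalize, Matrix.vecMul_smul, hw, smul_smul]

theorem exists_isNormal {y : Fin 8 → ℝ} (hy : ∀ i, 0 < y i) :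
    ∃ R : FramedRep, R.IsNormal y ∧ R.trace figureEight = traceForm y := by
  have h0 := hy 0
  have h1 := hy 1
  have h2 := hy 2
  have h3 := hy 3
  have h4 := hy 4
  have h5 := hy 5
  have h6 := hy 6
  have h7 := hy 7
  obtain ⟨Fα, rα⟩ := exists_isRep (v := ![1, 0, 0]) (w := ![0, 1, 1]) (by simp) (by simp) (by simp)
  obtain ⟨Fγ, rγ⟩ := exists_isRep (v := ![0, 1, 0]) (w := ![1, 0, 1]) (by simp) (by simp) (by simp)
  obtain ⟨Fβ, rβ⟩ := exists_isRep (v := ![0, 0, 1]) (w := ![y 6, 1, 0]) (by simp) (by simp)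
    (by simp [dotProduct, Fin.sum_univ_three])
  obtain ⟨Gγ, sγ⟩ := exists_isRep (v := ![y 2 * (1 + y 3), -(y 6 * y 2), y 6 * (1 + y 2)])
    (w := ![y 6 * y 7, y 7 * (1 + y 3) + y 3 * (1 + y 2), y 2 * y 3])
    (fun h => by have := congrFun h 1; simp [h6.ne', h2.ne'] at this)
    (fun h => by have := congrFun h 0; simp [h6.ne', h7.ne'] at this)
    (by simp [dotProduct, Fin.sum_univ_three]; ring)
  obtain ⟨Gα, sα⟩ := exists_isRep (v := ![-y 4, y 6 * (1 + y 4), y 4 * (1 + y 5)])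
    (w := ![y 5 * y 6 * (1 + y 4) + y 6 * y 7 * (1 + y 5), y 4 * y 5, y 6 * y 7])
    (fun h => by have := congrFun h 0; simp [h4.ne'] at this)
    (fun h => by have := congrFun h 2; simp [h6.ne', h7.ne'] at this)
    (by simp [dotProduct, Fin.sum_univ_three]; ring)
  have dA : 0 < (holα y).det := by rw [det_holα]; positivity
  have dD : 0 < (holγinv y).det := by rw [det_holγinv]; positivity
  set A := normalize (holα y) dA with hA
  set D := normalize (holγinv y) dD with hD
  have A1 : A • Fα = Fα := by
    refine (rα.normalize_smul dA (c := y 6 * y 7) (d := y 0 * y 1 * y 2 * y 3) ?_ ?_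
      (by positivity)).eq rα
    · ext i; fin_cases i <;> simp [holα, Matrix.mulVec, dotProduct, Fin.sum_univ_three]
    · ext i; fin_cases i <;> simp [holα, Matrix.vecMul, dotProduct, Fin.sum_univ_three] <;> ring
  have A2 : (A • Fβ).IsRep ![1 + y 0, y 0 * (1 + y 1), -y 0]
      ![y 0 * y 1, y 7, y 1 * (1 + y 0) + y 7 * (1 + y 1)] := by
    refine rβ.normalize_smul dA (c := y 2 * y 3) (d := y 0 * y 1 * y 7) ?_ ?_ (by positivity)
    · ext i; fin_cases i <;> simp [holα, Matrix.mulVec, dotProduct, Fin.sum_univ_three] <;> ring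
    · ext i; fin_cases i <;> simp [holα, Matrix.vecMul, dotProduct, Fin.sum_univ_three] <;> ring
  have A3 : A • Gγ = Fγ := by
    refine (sγ.normalize_smul dA (c := y 0 * y 1 * y 2 * y 3 * y 6) (d := 1) ?_ ?_
      one_ne_zero).eq rγ
    · ext i; fin_cases i <;> simp [holα, Matrix.mulVec, dotProduct, Fin.sum_univ_three] <;> ring
    · ext i; fin_cases i <;> simp [holα, Matrix.vecMul, dotProduct, Fin.sum_univ_three] <;> ring
  have D1 : D • Fγ = Fγ := by
    refine (rγ.normalize_smul dD (c := y 0 * y 1 * y 4 * y 5) (d := y 6 * y 7) ?_ ?_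
      (by positivity)).eq rγ
    · ext i; fin_cases i <;> simp [holγinv, Matrix.mulVec, dotProduct, Fin.sum_univ_three]
    · ext i; fin_cases i <;> simp [holγinv, Matrix.vecMul, dotProduct, Fin.sum_univ_three] <;> ring
  have D2 : D • Fβ = A • Fβ := by
    refine (rβ.normalize_smul dD (c := y 6 * y 7) (d := y 0 * y 1 * y 4 * y 5 * y 7) ?_ ?_
      (by positivity)).eq A2
    · ext i; fin_cases i <;> simp [holγinv, Matrix.mulVec, dotProduct, Fin.sum_univ_three] <;> ring
    · ext i; fin_cases i <;> simp [holγinv, Matrix.vecMul, dotProduct, Fin.sum_univ_three] <;> ring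
  have D3 : D • Gα = Fα := by
    refine (sα.normalize_smul dD (c := y 4 * y 5 * y 6 * y 7) (d := y 0 * y 1) ?_ ?_
      (by positivity)).eq rα
    · ext i; fin_cases i <;> simp [holγinv, Matrix.mulVec, dotProduct, Fin.sum_univ_three] <;> ring
    · ext i; fin_cases i <;> simp [holγinv, Matrix.vecMul, dotProduct, Fin.sum_univ_three] <;> ring
  -- The relation `α β γ = 1` determines the image of `β`.
  let f : Peripheral → PSL3 := fun c => match c with
    | .α => A
    | .β => A⁻¹ * D
    | .γ => D⁻¹
  let F : Peripheral → Flag := fun c => match c with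
    | .α => Fα
    | .β => Fβ
    | .γ => Fγ
  let ρ : π₁P →* PSL3 := PresentedGroup.toGroup (f := f) (by
    intro r hr
    rw [Set.mem_singleton_iff.1 hr]
    simp [f])
  have hρ (c : Peripheral) : ρ (loop c) = f c := PresentedGroup.toGroup.of _
  let R : FramedRep := ⟨ρ, F, fun c => by
    rw [hρ]
    cases c
    · exact A1
    · change (A⁻¹ * D) • Fβ = Fβ
      rw [mul_smul, inv_smul_eq_iff, D2]
    · change D⁻¹ • Fγ = Fγ
      rw [inv_smul_eq_iff, D1]⟩
  have eGβ : R.Gβ = A • Fβ := congrArg (· • Fβ) (hρ .α)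
  have eGγ : R.Gγ = Gγ := by
    have : R.Gγ = (A⁻¹ * D) • Fγ := congrArg (· • Fγ) (hρ .β)
    rw [this, mul_smul, inv_smul_eq_iff, D1, A3]
  have eGα : R.Gα = Gα := by
    have : R.Gα = D⁻¹ • Fα := congrArg (· • Fα) (hρ .γ)
    rw [this, inv_smul_eq_iff, D3]
  refine ⟨R, ⟨rα, rγ, rβ, eGβ ▸ A2, eGγ ▸ sγ, eGα ▸ sα⟩, ?_⟩
  have e : R.rho figureEight = A * D := by
    change ρ (loop .α * (loop .γ)⁻¹) = A * D
    rw [map_mul, map_inv, hρ, hρ]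
    exact congrArg (A * ·) (inv_inv D)
  rw [FramedRep.trace, e, Matrix.SpecialLinearGroup.coe_mul]
  change Matrix.trace (((holα y).det ^ (-1 / 3 : ℝ) • holα y) *
    ((holγinv y).det ^ (-1 / 3 : ℝ) • holγinv y)) = _
  rw [Matrix.smul_mul, Matrix.mul_smul, smul_smul, Matrix.trace_smul, trace_holα_mul_holγinv,
    ← Real.mul_rpow dA.le dD.le, det_holα, det_holγinv, traceForm, smul_eq_mul]
  congr 2
  ring

namespace FramedConvex

theorem exists_isNormal (x : FramedConvex) : ∃ R : FramedRep, R.IsNormal (coords x) ∧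
    (∀ i, 0 < coords x i) ∧ (Quotient.mk _ R : FramedCharacterVariety) = x.1 := by
  obtain ⟨x, R, hR, rfl⟩ := x
  obtain ⟨g, hg⟩ := hR.exists_isNormal
  exact ⟨g • R, hg, hR.2.2.2, Quotient.sound ⟨g, rfl⟩⟩

theorem coords_pos (x : FramedConvex) (i : Fin 8) : 0 < coords x i :=
  let ⟨_, _, h, _⟩ := x.exists_isNormal
  h i

theorem coords_injective : Function.Injective coords := by
  intro x x' h
  obtain ⟨R, hR, hp, e⟩ := x.exists_isNormal
  obtain ⟨R', hR', -, e'⟩ := x'.exists_isNormal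
  rw [h] at hR hp
  exact Subtype.ext (by rw [← e, ← e', hR.eq hR' hp])

theorem exists_coords_eq {y : Fin 8 → ℝ} (hy : y ∈ orthant) : ∃ x : FramedConvex, coords x = y := by
  obtain ⟨R, hR, -⟩ := Pants.exists_isNormal hy
  obtain ⟨hp, hc⟩ := hR.isPositive hy
  exact ⟨⟨Quotient.mk _ R, R, hp, rfl⟩, hc⟩

theorem tr_figureEight (x : FramedConvex) : tr figureEight x = traceForm (coords x) := by
  obtain ⟨R, hR, hp, e⟩ := x.exists_isNormal
  obtain ⟨R', hR', ht⟩ := Pants.exists_isNormal hp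
  rw [tr, ← e, ← ht, ← hR.eq hR' hp]
  rfl

/-! ### Hamiltonian curves in Fock-Goncharov coordinates -/

theorem inCoords_coords (f : FramedConvex → ℝ) (x : FramedConvex) :
    inCoords f (coords x) = f x :=
  coords_injective.extend_apply f 0 x

theorem isOpen_orthant : IsOpen orthant := by
  have : orthant = ⋂ i : Fin 8, {y : Fin 8 → ℝ | 0 < y i} := by
    ext y; simp [orthant]
  rw [this]
  exact isOpen_iInter_of_finite fun i => isOpen_lt continuous_const (continuous_apply i)

theorem orthant_mem_nhds (x : FramedConvex) : orthant ∈ nhds (coords x) :=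
  isOpen_orthant.mem_nhds (coords_pos x)

/-- A function given by a formula in the coordinates agrees with this formula on the orthant. -/
theorem inCoords_eqOn {f : FramedConvex → ℝ} {F : (Fin 8 → ℝ) → ℝ} (h : ∀ x, f x = F (coords x)) :
    Set.EqOn (inCoords f) F orthant := by
  intro y hy
  obtain ⟨x, rfl⟩ := exists_coords_eq hy
  rw [inCoords_coords, h]

theorem isSmooth_of_contDiffOn {f : FramedConvex → ℝ} {F : (Fin 8 → ℝ) → ℝ}
    (hF : ContDiffOn ℝ ∞ F orthant) (h : ∀ x, f x = F (coords x)) : IsSmooth f :=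
  hF.congr (inCoords_eqOn h)

theorem IsSmooth.hasFDerivAt {f : FramedConvex → ℝ} (hf : IsSmooth f) (x : FramedConvex) :
    HasFDerivAt (inCoords f) (fderiv ℝ (inCoords f) (coords x)) (coords x) :=
  ((hf.contDiffAt (orthant_mem_nhds x)).differentiableAt (by simp)).hasFDerivAt

theorem fderiv_inCoords_apply (f : FramedConvex → ℝ) (x : FramedConvex) (v : Fin 8 → ℝ) :
    fderiv ℝ (inCoords f) (coords x) v = ∑ i, v i * partialDeriv f i x := by
  conv_lhs => rw [← Finset.univ_sum_single v]
  rw [map_sum]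
  refine Finset.sum_congr rfl fun i _ => ?_
  have : (Pi.single i (v i) : Fin 8 → ℝ) = v i • Pi.single i 1 := by
    rw [← Pi.single_smul, smul_eq_mul, mul_one]
  rw [this, map_smul, smul_eq_mul, partialDeriv]

theorem isSmooth_coord (i : Fin 8) : IsSmooth fun x => coords x i :=
  isSmooth_of_contDiffOn (F := fun y => y i) (contDiff_apply ℝ ℝ i).contDiffOn fun _ => rfl

theorem partialDeriv_coord (i j : Fin 8) (x : FramedConvex) :
    partialDeriv (fun x => coords x i) j x = if j = i then 1 else 0 := by
  have h : inCoords (fun x => coords x i) =ᶠ[nhds (coords x)] fun y => y i :=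
    Filter.eventuallyEq_of_mem (orthant_mem_nhds x) (inCoords_eqOn fun _ => rfl)
  rw [partialDeriv, h.fderiv_eq, (hasFDerivAt_apply i (coords x)).fderiv]
  simp [Pi.single_apply, eq_comm]

/-- The components of the Hamiltonian vector field of `f` in Fock-Goncharov coordinates. -/
noncomputable def hamiltonianField (f : FramedConvex → ℝ) (x : FramedConvex) (i : Fin 8) : ℝ :=
  ∑ j, 2 * exchange i j * coords x i * coords x j * partialDeriv f j x

theorem bracket_eq (g f : FramedConvex → ℝ) (x : FramedConvex) :
    bracket g f x = ∑ i, hamiltonianField f x i * partialDeriv g i x := by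
  simp only [bracket, hamiltonianField, Finset.sum_mul]
  refine Finset.sum_congr rfl fun i _ => Finset.sum_congr rfl fun j _ => ?_
  ring

theorem isHamiltonianCurveOn_iff {f : FramedConvex → ℝ} {c : ℝ → FramedConvex} {s : Set ℝ} :
    IsHamiltonianCurveOn f c s ↔
      ∀ t ∈ s, HasDerivWithinAt (fun u => coords (c u)) (hamiltonianField f (c t)) s t := by
  constructor
  · intro h t ht
    rw [hasDerivWithinAt_pi]
    intro i
    have := h _ (isSmooth_coord i) t ht
    rw [bracket_eq] at this
    simpa [partialDeriv_coord] using this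
  · intro h g hg t ht
    have := (hg.hasFDerivAt (c t)).comp_hasDerivWithinAt t (h t ht)
    rw [fderiv_inCoords_apply, ← bracket_eq] at this
    exact this.congr (fun u _ => (inCoords_coords g (c u)).symm) (inCoords_coords g (c t)).symm

/-! ### Symplectic leaves -/

/-- The first of two vectors spanning the directions of the symplectic leaves in logarithmic
coordinates. -/
def leafU : Fin 8 → ℝ := ![1, -1, 1, -1, 1, -1, 0, 0]

/-- The second of two vectors spanning the directions of the symplectic leaves in logarithmic
coordinates. -/
def leafV : Fin 8 → ℝ := ![0, 0, 0, 0, 0, 0, 1, -1]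

/-- The exchange matrix has rank two. -/
theorem exchange_eq (i j : Fin 8) : exchange i j = leafU i * leafV j - leafV i * leafU j := by
  fin_cases i <;> fin_cases j <;> simp [exchange, leafU, leafV]

/-- The parametrisation of the symplectic leaf through the point with coordinates `y` by
`z = a + b i`, which is affine in logarithmic coordinates. -/
noncomputable def leafForm (y : Fin 8 → ℝ) (z : ℂ) : Fin 8 → ℝ :=
  fun i => y i * Real.exp (leafU i * z.re + leafV i * z.im)

theorem leafForm_mem {y : Fin 8 → ℝ} (hy : y ∈ orthant) (z : ℂ) : leafForm y z ∈ orthant :=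
  fun i => mul_pos (hy i) (Real.exp_pos _)

/-- The point of the symplectic leaf through `p` with parameter `z`. -/
noncomputable def leafPt (p : FramedConvex) (z : ℂ) : FramedConvex :=
  (exists_coords_eq (leafForm_mem (coords_pos p) z)).choose

variable {p : FramedConvex} {f : FramedConvex → ℝ}

theorem coords_leafPt (p : FramedConvex) (z : ℂ) :
    coords (leafPt p z) = leafForm (coords p) z :=
  (exists_coords_eq (leafForm_mem (coords_pos p) z)).choose_spec

theorem leafPt_zero (p : FramedConvex) : leafPt p 0 = p := by
  apply coords_injective
  rw [coords_leafPt]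
  ext i
  simp [leafForm]

theorem leafForm_injective {y : Fin 8 → ℝ} (hy : y ∈ orthant) :
    Function.Injective (leafForm y) := by
  intro z w h
  have h0 := congrFun h 0
  have h6 := congrFun h 6
  simp [leafForm, leafU, leafV, (hy 0).ne', (hy 6).ne'] at h0 h6
  exact Complex.ext h0 h6

theorem leafPt_injective (p : FramedConvex) : Function.Injective (leafPt p) := by
  intro z w h
  apply leafForm_injective (coords_pos p)
  rw [← coords_leafPt, h, coords_leafPt]

theorem contDiff_leafForm (y : Fin 8 → ℝ) : ContDiff ℝ ∞ (leafForm y) := by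
  refine contDiff_pi.2 fun i => ?_
  have h1 : ContDiff ℝ ∞ Complex.re := Complex.reCLM.contDiff
  have h2 : ContDiff ℝ ∞ Complex.im := Complex.imCLM.contDiff
  unfold leafForm
  fun_prop

theorem hasFDerivAt_leafForm (y : Fin 8 → ℝ) (z : ℂ) :
    HasFDerivAt (leafForm y) (ContinuousLinearMap.pi fun i =>
      leafForm y z i • (leafU i • Complex.reCLM + leafV i • Complex.imCLM)) z := by
  refine hasFDerivAt_pi.2 fun i => ?_
  have h : HasFDerivAt (fun z : ℂ => leafU i * z.re + leafV i * z.im)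
      (leafU i • Complex.reCLM + leafV i • Complex.imCLM) z :=
    (Complex.reCLM.hasFDerivAt.const_mul (leafU i)).add
      (Complex.imCLM.hasFDerivAt.const_mul (leafV i))
  refine (h.exp.const_mul (y i)).congr_fderiv ?_
  rw [smul_smul]
  rfl

theorem comp_leafPt (f : FramedConvex → ℝ) (p : FramedConvex) :
    f ∘ leafPt p = inCoords f ∘ leafForm (coords p) := by
  ext z
  rw [Function.comp_apply, Function.comp_apply, ← coords_leafPt, inCoords_coords]

theorem IsSmooth.contDiff_comp_leafPt (hf : IsSmooth f) (p : FramedConvex) :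
    ContDiff ℝ ∞ (f ∘ leafPt p) := by
  rw [comp_leafPt, ← contDiffOn_univ]
  exact hf.comp (contDiff_leafForm _).contDiffOn fun z _ => leafForm_mem (coords_pos p) z

theorem IsSmooth.fderiv_comp_leafPt (hf : IsSmooth f) (p : FramedConvex) (z w : ℂ) :
    fderiv ℝ (f ∘ leafPt p) z w = ∑ j, coords (leafPt p z) j * (leafU j * w.re + leafV j * w.im) *
      partialDeriv f j (leafPt p z) := by
  have h1 := hf.hasFDerivAt (leafPt p z)
  have h2 := hasFDerivAt_leafForm (coords p) z
  rw [coords_leafPt] at h1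
  rw [comp_leafPt, (h1.comp z h2).fderiv, ContinuousLinearMap.comp_apply, ← coords_leafPt,
    fderiv_inCoords_apply]
  rfl

/-- The Hamiltonian vector field of a function on the plane with respect to the Poisson bracket
`{a, b} = 2`. -/
noncomputable def planarField (h : ℂ → ℝ) (z : ℂ) : ℂ :=
  ⟨2 * fderiv ℝ h z Complex.I, -(2 * fderiv ℝ h z 1)⟩

theorem hamiltonianField_eq (f : FramedConvex → ℝ) (x : FramedConvex) (i : Fin 8) :
    hamiltonianField f x i = coords x i * (leafU i * (2 * ∑ j, coords x j * leafV j *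
      partialDeriv f j x) + leafV i * -(2 * ∑ j, coords x j * leafU j * partialDeriv f j x)) := by
  simp only [hamiltonianField, exchange_eq, Finset.mul_sum, ← Finset.sum_neg_distrib,
    ← Finset.sum_add_distrib]
  refine Finset.sum_congr rfl fun j _ => ?_
  ring

theorem IsSmooth.hamiltonianField_leafPt (hf : IsSmooth f) (p : FramedConvex) (z : ℂ) (i : Fin 8) :
    hamiltonianField f (leafPt p z) i = coords (leafPt p z) i *
      (leafU i * (planarField (f ∘ leafPt p) z).re +
        leafV i * (planarField (f ∘ leafPt p) z).im) := by
  rw [hamiltonianField_eq]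
  simp [planarField, hf.fderiv_comp_leafPt]

theorem IsSmooth.isHamiltonianCurveOn_leafPt (hf : IsSmooth f) {z : ℝ → ℂ} {s : Set ℝ}
    (hz : ∀ t ∈ s, HasDerivWithinAt z (planarField (f ∘ leafPt p) (z t)) s t) :
    IsHamiltonianCurveOn f (fun t => leafPt p (z t)) s := by
  rw [isHamiltonianCurveOn_iff]
  intro t ht
  have := (hasFDerivAt_leafForm (coords p) (z t)).comp_hasDerivWithinAt t (hz t ht)
  simp only [coords_leafPt]
  refine this.congr_deriv ?_
  ext i
  rw [hf.hamiltonianField_leafPt, coords_leafPt]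
  rfl

/-- A Hamiltonian curve that starts on the leaf through `p` stays there, because the linear
functions of the logarithmic coordinates that are constant on the leaf are Casimir functions; its
parameter is an integral curve of the planar Hamiltonian vector field. -/
theorem IsSmooth.exists_lift (hf : IsSmooth f) {c : ℝ → FramedConvex} {s : Set ℝ}
    (hs : s.OrdConnected) (h0 : 0 ∈ s) (hc : IsHamiltonianCurveOn f c s) {z₀ : ℂ}
    (hz₀ : c 0 = leafPt p z₀) : ∃ z : ℝ → ℂ, z 0 = z₀ ∧ ∀ t ∈ s, c t = leafPt p (z t) ∧
      HasDerivWithinAt z (planarField (f ∘ leafPt p) (z t)) s t := by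
  rw [isHamiltonianCurveOn_iff] at hc
  let l (i : Fin 8) (t : ℝ) : ℝ := Real.log (coords (c t) i) - Real.log (coords p i)
  let A (t : ℝ) : ℝ := 2 * ∑ j, coords (c t) j * leafV j * partialDeriv f j (c t)
  let B (t : ℝ) : ℝ := -(2 * ∑ j, coords (c t) j * leafU j * partialDeriv f j (c t))
  have hl (i : Fin 8) (t : ℝ) (ht : t ∈ s) :
      HasDerivWithinAt (l i) (leafU i * A t + leafV i * B t) s t := by
    have h1 := (hasDerivWithinAt_pi.1 (hc t ht) i).log (coords_pos (c t) i).ne'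
    rw [hamiltonianField_eq, mul_div_cancel_left₀ _ (coords_pos (c t) i).ne'] at h1
    exact h1.sub_const _
  have l0 (i : Fin 8) : l i 0 = leafU i * z₀.re + leafV i * z₀.im := by
    simp only [l]
    rw [hz₀, coords_leafPt, leafForm, Real.log_mul (coords_pos p i).ne' (Real.exp_ne_zero _),
      Real.log_exp]
    ring
  have hconst (i : Fin 8) (t : ℝ) (ht : t ∈ s) : l i t = leafU i * l 0 t + leafV i * l 6 t := by
    have hd (t : ℝ) (ht : t ∈ s) : HasDerivWithinAt
        (fun t => l i t - (leafU i * l 0 t + leafV i * l 6 t)) 0 s t := by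
      refine ((hl i t ht).sub (((hl 0 t ht).const_mul (leafU i)).add
        ((hl 6 t ht).const_mul (leafV i)))).congr_deriv ?_
      simp [leafU, leafV]
    have := hs.convex.norm_image_sub_le_of_norm_hasDerivWithin_le hd (C := 0) (by simp) h0 ht
    rw [zero_mul, norm_le_zero_iff, l0, l0, l0] at this
    simp [leafU, leafV] at this ⊢
    linarith
  have hct (t : ℝ) (ht : t ∈ s) : c t = leafPt p ⟨l 0 t, l 6 t⟩ := by
    apply coords_injective
    rw [coords_leafPt]
    ext i
    rw [leafForm, ← hconst i t ht, Real.exp_sub, Real.exp_log (coords_pos _ i),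
      Real.exp_log (coords_pos _ i), mul_div_cancel₀ _ (coords_pos _ i).ne']
  refine ⟨fun t => ⟨l 0 t, l 6 t⟩, ?_, fun t ht => ⟨hct t ht, ?_⟩⟩
  · apply Complex.ext <;> simp [l0] <;> simp [leafU, leafV]
  · have h1 : planarField (f ∘ leafPt p) ⟨l 0 t, l 6 t⟩ = ⟨A t, B t⟩ := by
      simp only [planarField, hf.fderiv_comp_leafPt, ← hct t ht, A, B]
      simp
    have e (x y : ℝ) : (⟨x, y⟩ : ℂ) = x + y * Complex.I := by apply Complex.ext <;> simp
    rw [h1]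
    simp only [e]
    have k0 := hl 0 t ht
    have k6 := hl 6 t ht
    simp only [leafU, leafV, Matrix.cons_val, one_mul, zero_mul, add_zero, zero_add] at k0 k6
    exact k0.ofReal_comp.add (k6.ofReal_comp.mul_const _)

/-- Every point of the plane is reached from the origin by the flow of a function that is linear
in logarithmic coordinates. -/
theorem hamiltonianStep_leafPt (p : FramedConvex) (z : ℂ) : HamiltonianStep p (leafPt p z) := by
  let F (y : Fin 8 → ℝ) : ℝ := z.re / 2 * Real.log (y 6) - z.im / 2 * Real.log (y 0)
  have hF : ContDiffOn ℝ ∞ F orthant := by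
    have h (i : Fin 8) : ContDiffOn ℝ ∞ (fun y : Fin 8 → ℝ => Real.log (y i)) orthant :=
      (contDiff_apply ℝ ℝ i).contDiffOn.log fun y hy => (hy i).ne'
    exact (contDiffOn_const.mul (h 6)).sub (contDiffOn_const.mul (h 0))
  have hf : IsSmooth fun x => F (coords x) := isSmooth_of_contDiffOn hF fun _ => rfl
  have hcomp : (fun x => F (coords x)) ∘ leafPt p =
      fun w => (z.re / 2) * w.im - (z.im / 2) * w.re + F (coords p) := by
    ext w
    simp only [Function.comp_apply, F, coords_leafPt, leafForm]
    rw [Real.log_mul (coords_pos p _).ne' (Real.exp_ne_zero _), Real.log_exp,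
      Real.log_mul (coords_pos p _).ne' (Real.exp_ne_zero _), Real.log_exp]
    simp [leafU, leafV]
    ring
  have hfield (w : ℂ) : planarField ((fun x => F (coords x)) ∘ leafPt p) w = z := by
    have h : HasFDerivAt (fun w : ℂ => (z.re / 2) * w.im - (z.im / 2) * w.re + F (coords p))
        ((z.re / 2) • Complex.imCLM - (z.im / 2) • Complex.reCLM) w :=
      ((Complex.imCLM.hasFDerivAt.const_mul _).sub
        (Complex.reCLM.hasFDerivAt.const_mul _)).add_const _
    rw [hcomp, planarField, h.fderiv]
    apply Complex.ext <;> simp <;> ring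
  refine ⟨_, hf, fun t => leafPt p (t • z), hf.isHamiltonianCurveOn_leafPt fun t _ => ?_, ?_, ?_⟩
  · rw [hfield]
    simpa using ((hasDerivAt_id t).smul_const z).hasDerivWithinAt
  · simp [leafPt_zero]
  · simp

theorem leaf_eq_range (p : FramedConvex) :
    {q | Relation.ReflTransGen HamiltonianStep p q} = Set.range (leafPt p) := by
  ext q
  constructor
  · intro h
    induction h with
    | refl => exact ⟨0, leafPt_zero p⟩
    | tail _ hstep ih =>
      obtain ⟨z₀, rfl⟩ := ih
      obtain ⟨f, hf, c, hc, h0, rfl⟩ := hstep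
      obtain ⟨z, -, hz⟩ := hf.exists_lift Set.ordConnected_Icc (by simp) hc h0
      exact ⟨z 1, (hz 1 (by simp)).1.symm⟩
  · rintro ⟨z, rfl⟩
    exact .single (hamiltonianStep_leafPt p z)

end FramedConvex

theorem isEmbeddedSurface_range_leafForm {y : Fin 8 → ℝ} (hy : y ∈ FramedConvex.orthant) :
    IsEmbeddedSurface (Set.range (FramedConvex.leafForm y)) := by
  intro x _
  let e : (Fin 2 → ℝ) →L[ℝ] ℂ :=
    (Complex.equivRealProdCLM.symm : ℝ × ℝ →L[ℝ] ℂ).comp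
      ((ContinuousLinearMap.proj 0).prod (ContinuousLinearMap.proj 1))
  have he (v : Fin 2 → ℝ) : e v = ⟨v 0, v 1⟩ := by
    apply Complex.ext <;> simp [e]
  have hinj : Function.Injective e := by
    intro v w h
    rw [he, he, Complex.mk.injEq] at h
    ext i
    fin_cases i
    · exact h.1
    · exact h.2
  let g (x : Fin 8 → ℝ) : Fin 2 → ℝ := ![Real.log (x 0 / y 0), Real.log (x 6 / y 6)]
  have hg (v : Fin 2 → ℝ) : g (FramedConvex.leafForm y (e v)) = v := by
    rw [he]
    ext i
    fin_cases i <;>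
      simp [g, FramedConvex.leafForm, FramedConvex.leafU, FramedConvex.leafV, (hy 0).ne',
        (hy 6).ne']
  refine ⟨Set.univ, isOpen_univ, trivial, Set.univ, FramedConvex.leafForm y ∘ e, isOpen_univ, ?_, ?_,
    ?_, ?_⟩
  · exact ((FramedConvex.contDiff_leafForm y).comp e.contDiff).contDiffOn
  · intro v _
    rw [((FramedConvex.hasFDerivAt_leafForm y (e v)).comp v e.hasFDerivAt).fderiv]
    intro z w h
    apply hinj
    have h0 := congrFun h 0
    have h6 := congrFun h 6
    simp [FramedConvex.leafForm, FramedConvex.leafU, FramedConvex.leafV, (hy 0).ne',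
      (hy 6).ne'] at h0 h6
    exact Complex.ext h0 h6
  · have hcont : Continuous (FramedConvex.leafForm y ∘ e) :=
      (FramedConvex.contDiff_leafForm y).continuous.comp e.continuous
    have hgcont : ContinuousOn g FramedConvex.orthant := by
      refine continuousOn_pi.2 fun i => ?_
      have k (j : Fin 8) : ContinuousOn (fun x : Fin 8 → ℝ => Real.log (x j / y j))
          FramedConvex.orthant :=
        ((continuous_apply j).div_const _).continuousOn.log
          fun x hx => (div_pos (hx j) (hy j)).ne'
      fin_cases i
      · exact k 0
      · exact k 6
    refine ⟨⟨?_⟩, ?_⟩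
    · refine le_antisymm ?_ ?_
      · exact (hcont.comp continuous_subtype_val).le_induced
      · intro u hu
        rw [isOpen_induced_iff] at hu
        obtain ⟨u', hu', rfl⟩ := hu
        obtain ⟨W, hW, hW'⟩ := (continuousOn_iff'.1 hgcont) u' hu'
        refine isOpen_induced_iff.2 ⟨W ∩ FramedConvex.orthant,
          hW.inter FramedConvex.isOpen_orthant, ?_⟩
        rw [← hW']
        ext ⟨v, hv⟩
        have := FramedConvex.leafForm_mem hy (e v)
        simp [Set.domRestrict, hg, this]
    · rintro ⟨v, hv⟩ ⟨w, hw⟩ h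
      exact Subtype.ext (hinj (FramedConvex.leafForm_injective hy h))
  · rw [Set.image_univ, Set.inter_univ, Set.range_comp, Function.Surjective.range_eq, Set.image_univ]
    intro z
    exact ⟨![z.re, z.im], by rw [he]; rfl⟩

/-! ### Global integral curves -/

section ODE

variable {E : Type*} [NormedAddCommGroup E] [NormedSpace ℝ E] {V : E → E} {K L : NNReal}

/-- Integral curves of a Lipschitz vector field on an interval are determined by their value
at one time. -/
theorem eqOn_of_hasDerivWithinAt (hV : LipschitzWith K V) {s : Set ℝ} (hs : s.OrdConnected)
    (h0 : 0 ∈ s) {z w : ℝ → E} (hz : ∀ t ∈ s, HasDerivWithinAt z (V (z t)) s t)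
    (hw : ∀ t ∈ s, HasDerivWithinAt w (V (w t)) s t) (h : z 0 = w 0) : Set.EqOn z w s := by
  intro t ht
  rcases le_total 0 t with h0t | h0t
  · have hsub : Set.Icc 0 t ⊆ s := hs.out h0 ht
    have key {z : ℝ → E} (hz : ∀ t ∈ s, HasDerivWithinAt z (V (z t)) s t) :
        ∀ τ ∈ Set.Ico 0 t, HasDerivWithinAt z (V (z τ)) (Set.Ici τ) τ := fun τ hτ =>
      (hz τ (hsub ⟨hτ.1, hτ.2.le⟩)).mono_of_mem_nhdsWithin
        (Filter.mem_of_superset (Icc_mem_nhdsGE hτ.2)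
          ((Set.Icc_subset_Icc_left hτ.1).trans hsub))
    exact ODE_solution_unique_of_mem_Icc_right (v := fun _ => V) (s := fun _ => Set.univ)
      (fun _ _ => hV.lipschitzOnWith) (fun τ hτ => (hz τ (hsub hτ)).continuousWithinAt.mono hsub)
      (key hz) (fun _ _ => trivial)
      (fun τ hτ => (hw τ (hsub hτ)).continuousWithinAt.mono hsub) (key hw) (fun _ _ => trivial) h
      ⟨h0t, le_rfl⟩
  · have hsub : Set.Icc t 0 ⊆ s := hs.out ht h0
    have key {z : ℝ → E} (hz : ∀ t ∈ s, HasDerivWithinAt z (V (z t)) s t) :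
        ∀ τ ∈ Set.Ioc t 0, HasDerivWithinAt z (V (z τ)) (Set.Iic τ) τ := fun τ hτ =>
      (hz τ (hsub ⟨hτ.1.le, hτ.2⟩)).mono_of_mem_nhdsWithin
        (Filter.mem_of_superset (Icc_mem_nhdsLE hτ.1)
          ((Set.Icc_subset_Icc_right hτ.2).trans hsub))
    exact ODE_solution_unique_of_mem_Icc_left (v := fun _ => V) (s := fun _ => Set.univ)
      (fun _ _ => hV.lipschitzOnWith) (fun τ hτ => (hz τ (hsub hτ)).continuousWithinAt.mono hsub)
      (key hz) (fun _ _ => trivial)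
      (fun τ hτ => (hw τ (hsub hτ)).continuousWithinAt.mono hsub) (key hw) (fun _ _ => trivial) h
      ⟨le_rfl, h0t⟩

theorem exists_integralCurve [CompleteSpace E] (hV : LipschitzWith K V) (hL : ∀ x, ‖V x‖ ≤ L)
    (x : E) : ∃ z : ℝ → E, z 0 = x ∧ ∀ t, HasDerivAt z (V (z t)) t := by
  have hloc (a : ℝ) (ha : 0 < a) : ∃ z : ℝ → E, z 0 = x ∧
      ∀ t ∈ Set.Icc (-a) a, HasDerivWithinAt z (V (z t)) (Set.Icc (-a) a) t := by
    have hP : IsPicardLindelof (fun _ => V) (tmin := -a) (tmax := a)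
        ⟨0, by constructor <;> linarith⟩ x (L * a.toNNReal) 0 L K :=
      { lipschitzOnWith := fun _ _ => hV.lipschitzOnWith
        continuousOn := fun _ _ => continuousOn_const
        norm_le := fun _ _ x _ => hL x
        mul_max_le := by simp [ha.le] }
    exact hP.exists_eq_forall_mem_Icc_hasDerivWithinAt₀
  choose! γ hγ0 hγ using hloc
  have heq (a b : ℝ) (ha : 0 < a) (hab : a ≤ b) : Set.EqOn (γ a) (γ b) (Set.Icc (-a) a) := by
    have hsub : Set.Icc (-a) a ⊆ Set.Icc (-b) b := Set.Icc_subset_Icc (by linarith) hab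
    exact eqOn_of_hasDerivWithinAt hV Set.ordConnected_Icc ⟨by linarith, ha.le⟩ (hγ a ha)
      (fun t ht => (hγ b (ha.trans_le hab) t (hsub ht)).mono hsub)
      (by rw [hγ0 a ha, hγ0 b (ha.trans_le hab)])
  have hmem (t : ℝ) : t ∈ Set.Icc (-(|t| + 1)) (|t| + 1) :=
    abs_le.1 (by linarith)
  have hpos (t : ℝ) : 0 < |t| + 1 := by positivity
  have hglue (a t : ℝ) (ht : t ∈ Set.Ioo (-a) a) : γ (|t| + 1) t = γ a t := by
    have ha : 0 < a := by linarith [ht.1, ht.2]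
    rcases le_total a (|t| + 1) with h | h
    · exact (heq a _ ha h ⟨ht.1.le, ht.2.le⟩).symm
    · exact heq _ a (hpos t) h (hmem t)
  refine ⟨fun t => γ (|t| + 1) t, hγ0 _ (hpos 0), fun t => ?_⟩
  have ht : t ∈ Set.Ioo (-(|t| + 1)) (|t| + 1) := abs_lt.1 (by linarith)
  refine ((hγ _ (hpos t) t (hmem t)).hasDerivAt (Icc_mem_nhds ht.1 ht.2)).congr_of_eventuallyEq ?_
  filter_upwards [Ioo_mem_nhds ht.1 ht.2] with u hu using hglue _ u hu

end ODE

/-! ### Hamiltonian flows of strictly convex proper functions on the plane -/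

namespace FramedConvex

section Planar

variable {h : ℂ → ℝ} {z₀ : ℂ}

theorem fderiv_planarField (h : ℂ → ℝ) (z : ℂ) : fderiv ℝ h z (planarField h z) = 0 := by
  have e : planarField h z = (2 * fderiv ℝ h z Complex.I) • (1 : ℂ) +
      (-(2 * fderiv ℝ h z 1)) • Complex.I := by
    apply Complex.ext <;> simp [planarField]
  conv_lhs => rw [e, map_add, map_smul, map_smul, smul_eq_mul, smul_eq_mul]
  ring

/-- The Hamiltonian vector field turns clockwise around `z₀` where `h` increases radially. -/
theorem im_planarField_div (h : ℂ → ℝ) (z w : ℂ) :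
    (planarField h z / w).im = -(2 * fderiv ℝ h z w / Complex.normSq w) := by
  have e : w = w.re • (1 : ℂ) + w.im • Complex.I := by
    apply Complex.ext <;> simp
  have e2 : fderiv ℝ h z w = w.re * fderiv ℝ h z 1 + w.im * fderiv ℝ h z Complex.I := by
    conv_lhs => rw [e, map_add, map_smul, map_smul, smul_eq_mul, smul_eq_mul]
  rw [Complex.div_im, e2, planarField]
  ring

theorem contDiff_planarField (hh : ContDiff ℝ ∞ h) : ContDiff ℝ 1 (planarField h) := by
  have k (v : ℂ) : ContDiff ℝ 1 fun z => ((fderiv ℝ h z v : ℝ) : ℂ) :=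
    Complex.ofRealCLM.contDiff.comp
      ((hh.fderiv_right (m := 1) (by norm_cast)).clm_apply contDiff_const)
  have e : planarField h = fun z => 2 * ((fderiv ℝ h z Complex.I : ℝ) : ℂ) +
      -(2 * ((fderiv ℝ h z 1 : ℝ) : ℂ)) * Complex.I := by
    ext z
    apply Complex.ext <;> simp [planarField]
  rw [e]
  exact (contDiff_const.mul (k _)).add ((contDiff_const.mul (k _)).neg.mul contDiff_const)

/-- The value of the Hamiltonian is constant along the integral curves of any multiple of its
Hamiltonian vector field. -/
theorem eq_of_hasDerivWithinAt_smul (hh : ContDiff ℝ ∞ h) {s : Set ℝ} (hs : s.OrdConnected)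
    (h0 : 0 ∈ s) {χ : ℂ → ℝ} {z : ℝ → ℂ}
    (hz : ∀ t ∈ s, HasDerivWithinAt z (χ (z t) • planarField h (z t)) s t) :
    ∀ t ∈ s, h (z t) = h (z 0) := by
  intro t ht
  have hd (t : ℝ) (ht : t ∈ s) : HasDerivWithinAt (h ∘ z) 0 s t := by
    have := ((hh.differentiable (by simp)) (z t)).hasFDerivAt.comp_hasDerivWithinAt t (hz t ht)
    rwa [map_smul, fderiv_planarField, smul_zero] at this
  have := hs.convex.norm_image_sub_le_of_norm_hasDerivWithin_le hd (C := 0) (by simp) h0 ht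
  rw [zero_mul, norm_le_zero_iff, sub_eq_zero] at this
  exact this

theorem isCompact_sublevel (hc : Continuous h)
    (hlim : Filter.Tendsto h (Filter.cocompact ℂ) Filter.atTop) (c : ℝ) :
    IsCompact {z | h z ≤ c} := by
  have := hlim.eventually (Filter.eventually_gt_atTop c)
  obtain ⟨t, ht, hts⟩ := Filter.mem_cocompact.1 this
  refine ht.of_isClosed_subset (isClosed_le hc continuous_const) fun z hz => ?_
  by_contra hn
  exact (not_lt.2 hz : ¬c < h z) (hts hn)

/-- On a sublevel set, the Hamiltonian vector field agrees with a compactly supported multiple of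
itself, which is Lipschitz and bounded; its integral curves still preserve `h`, so that those
starting in the sublevel set never leave it. -/
theorem exists_cutoff (hh : ContDiff ℝ ∞ h)
    (hlim : Filter.Tendsto h (Filter.cocompact ℂ) Filter.atTop) (c : ℝ) :
    ∃ (χ : ℂ → ℝ) (K L : NNReal), (∀ z, h z ≤ c → χ z = 1) ∧
      LipschitzWith K (fun z => χ z • planarField h z) ∧ ∀ z, ‖χ z • planarField h z‖ ≤ L := by
  obtain ⟨r, hr⟩ := (isCompact_sublevel hh.continuous hlim c).isBounded.subset_closedBall 0
  let χ : ContDiffBump (0 : ℂ) := ⟨|r| + 1, |r| + 2, by positivity, by linarith⟩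
  have hsmooth : ContDiff ℝ 1 fun z => χ z • planarField h z :=
    χ.contDiff.smul (contDiff_planarField hh)
  have hsupp : HasCompactSupport fun z => χ z • planarField h z := χ.hasCompactSupport.smul_right
  obtain ⟨K, hK⟩ := hsmooth.lipschitzWith_of_hasCompactSupport hsupp (by simp)
  obtain ⟨L, hL⟩ := hsupp.exists_bound_of_continuous hsmooth.continuous
  refine ⟨χ, K, L.toNNReal, fun z hz => ?_, hK, fun z => (hL z).trans (Real.le_coe_toNNReal L)⟩
  refine χ.one_of_mem_closedBall (Metric.closedBall_subset_closedBall ?_ (hr hz))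
  exact (le_abs_self r).trans (by simp [χ])

theorem planarField_unique (hh : ContDiff ℝ ∞ h)
    (hlim : Filter.Tendsto h (Filter.cocompact ℂ) Filter.atTop) {s : Set ℝ} (hs : s.OrdConnected)
    (h0 : 0 ∈ s) {z w : ℝ → ℂ} (hz : ∀ t ∈ s, HasDerivWithinAt z (planarField h (z t)) s t)
    (hw : ∀ t ∈ s, HasDerivWithinAt w (planarField h (w t)) s t) (h' : z 0 = w 0) :
    ∀ t ∈ s, z t = w t := by
  obtain ⟨χ, K, L, hχ, hK, -⟩ := exists_cutoff hh hlim (h (z 0))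
  have key {w : ℝ → ℂ} (hw : ∀ t ∈ s, HasDerivWithinAt w (planarField h (w t)) s t)
      (h' : z 0 = w 0) : ∀ t ∈ s, HasDerivWithinAt w (χ (w t) • planarField h (w t)) s t := by
    intro t ht
    have := eq_of_hasDerivWithinAt_smul hh hs h0 (χ := fun _ => 1) (by simpa using hw) t ht
    rw [hχ _ (by rw [this, h']), one_smul]
    exact hw t ht
  exact eqOn_of_hasDerivWithinAt hK hs h0 (key hz rfl) (key hw h') h'

theorem exists_planar_curve (hh : ContDiff ℝ ∞ h)
    (hlim : Filter.Tendsto h (Filter.cocompact ℂ) Filter.atTop) (x : ℂ) :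
    ∃ z : ℝ → ℂ, z 0 = x ∧ ∀ t, HasDerivAt z (planarField h (z t)) t := by
  obtain ⟨χ, K, L, hχ, hK, hL⟩ := exists_cutoff hh hlim (h x)
  obtain ⟨z, hz0, hz⟩ := exists_integralCurve hK hL x
  refine ⟨z, hz0, fun t => ?_⟩
  have := eq_of_hasDerivWithinAt_smul hh Set.ordConnected_univ trivial
    (fun t _ => (hz t).hasDerivWithinAt) t trivial
  have := hz t
  rwa [hχ _ (by rw [‹h (z t) = _›, hz0]), one_smul] at this

theorem fderiv_sub_pos (hh : ContDiff ℝ ∞ h) (hconv : StrictConvexOn ℝ Set.univ h)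
    (hmin : ∀ z, h z₀ ≤ h z) {z : ℂ} (hz : z ≠ z₀) : 0 < fderiv ℝ h z (z - z₀) := by
  let φ : ℝ →ᵃ[ℝ] ℂ := AffineMap.lineMap z₀ z
  have h1 : ConvexOn ℝ Set.univ (h ∘ φ) := hconv.convexOn.comp_affineMap φ
  have h2 : HasDerivAt (h ∘ φ) (fderiv ℝ h z (z - z₀)) 1 := by
    have h3 : HasFDerivAt h (fderiv ℝ h z) (φ 1) := by
      rw [show φ 1 = z from AffineMap.lineMap_apply_one _ _]
      exact ((hh.differentiable (by simp)) z).hasFDerivAt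
    exact h3.comp_hasDerivAt 1 AffineMap.hasDerivAt_lineMap
  have h3 := h1.slope_le_of_hasDerivAt (Set.mem_univ 0) (Set.mem_univ 1) one_pos h2
  refine lt_of_lt_of_le ?_ h3
  have h4 : h z₀ < h z := lt_of_le_of_ne (hmin z) fun e => hz
    (hconv.eq_of_isMinOn (fun w _ => e ▸ hmin w) (fun w _ => hmin w) trivial trivial)
  simpa [slope_def_field, φ] using h4

/-- A strictly convex function is injective on open rays from its minimum. -/
theorem eq_one_of_ray (hconv : StrictConvexOn ℝ Set.univ h) (hmin : ∀ z, h z₀ ≤ h z) {w : ℂ}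
    (hw : w ≠ 0) {r : ℝ} (hr : 0 < r) (e : h (z₀ + r • w) = h (z₀ + w)) : r = 1 := by
  have key {w : ℂ} {r : ℝ} (hw : w ≠ 0) (hr : 0 < r) (hr1 : r < 1) :
      h (z₀ + r • w) < h (z₀ + w) := by
    have := hconv.2 (Set.mem_univ z₀) (Set.mem_univ (z₀ + w)) (by simpa using hw)
      (sub_pos.2 hr1) hr (by ring)
    have e2 : (1 - r) • z₀ + r • (z₀ + w) = z₀ + r • w := by module
    rw [e2, smul_eq_mul, smul_eq_mul] at this
    nlinarith [hmin (z₀ + w)]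
  rcases lt_trichotomy r 1 with h1 | h1 | h1
  · exact absurd e (key hw hr h1).ne
  · exact h1
  · have := key (w := r • w) (r := r⁻¹) (smul_ne_zero hr.ne' hw) (inv_pos.2 hr)
      (inv_lt_one_of_one_lt₀ h1)
    rw [smul_smul, inv_mul_cancel₀ hr.ne', one_smul] at this
    exact absurd e this.ne'

/-- An integral curve of the Hamiltonian vector field turns around the minimum with an angular
velocity that is bounded away from zero on its level set. After a full turn it meets its initial ray
in a point of the same level, hence in its initial point. -/
theorem exists_periodic (hh : ContDiff ℝ ∞ h) (hconv : StrictConvexOn ℝ Set.univ h)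
    (hlim : Filter.Tendsto h (Filter.cocompact ℂ) Filter.atTop) (hmin : ∀ z, h z₀ ≤ h z)
    {z : ℝ → ℂ} (hz : ∀ t, HasDerivAt z (planarField h (z t)) t) (h0 : z 0 ≠ z₀) :
    ∃ T : ℝ, 0 < T ∧ Function.Periodic z T := by
  have hlevel (t : ℝ) : h (z t) = h (z 0) :=
    eq_of_hasDerivWithinAt_smul hh Set.ordConnected_univ trivial (χ := fun _ => 1)
      (fun t _ => by simpa only [one_smul] using (hz t).hasDerivWithinAt) t trivial
  have hlt : h z₀ < h (z 0) := lt_of_le_of_ne (hmin _) fun e => h0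
    (hconv.eq_of_isMinOn (fun w _ => e ▸ hmin w) (fun w _ => hmin w) trivial trivial)
  have hne {w : ℂ} (hw : h w = h (z 0)) : w ≠ z₀ := fun e => hlt.ne (e ▸ hw)
  have hV := (contDiff_planarField hh).continuous
  have hzc : Continuous z := continuous_iff_continuousAt.2 fun t => (hz t).continuousAt
  -- `L` is a logarithm of `z - z₀` along the curve.
  let ℓ (t : ℝ) : ℂ := planarField h (z t) / (z t - z₀)
  have hℓ : Continuous ℓ := (hV.comp hzc).div (hzc.sub continuous_const)
    fun t => sub_ne_zero.2 (hne (hlevel t))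
  let L (t : ℝ) : ℂ := ∫ u in (0 : ℝ)..t, ℓ u
  have hL (t : ℝ) : HasDerivAt L (ℓ t) t := (hℓ.integral_hasStrictDerivAt 0 t).hasDerivAt
  have hL0 : L 0 = 0 := intervalIntegral.integral_same
  have hzL (t : ℝ) : z t - z₀ = (z 0 - z₀) * Complex.exp (L t) := by
    have hd (t : ℝ) : HasDerivAt (fun t => (z t - z₀) * Complex.exp (-L t)) 0 t := by
      refine (((hz t).sub_const z₀).mul (hL t).neg.cexp).congr_deriv ?_
      have : planarField h (z t) = ℓ t * (z t - z₀) :=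
        (div_mul_cancel₀ _ (sub_ne_zero.2 (hne (hlevel t)))).symm
      rw [this]
      ring
    have := is_const_of_deriv_eq_zero (fun t => (hd t).differentiableAt) (fun t => (hd t).deriv) t 0
    simp only [hL0, neg_zero, Complex.exp_zero, mul_one] at this
    rw [← this, mul_assoc, ← Complex.exp_add, neg_add_cancel, Complex.exp_zero, mul_one]
  -- A lower bound for the angular velocity on the level set.
  obtain ⟨c, hc, hcb⟩ : ∃ c : ℝ, 0 < c ∧ ∀ t, c ≤ -(ℓ t).im := by
    have hK : IsCompact {w | h w = h (z 0)} :=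
      (isCompact_sublevel hh.continuous hlim (h (z 0))).of_isClosed_subset
        (isClosed_eq hh.continuous continuous_const) fun w hw => le_of_eq hw
    have hcont : ContinuousOn (fun w => -(planarField h w / (w - z₀)).im) {w | h w = h (z 0)} :=
      (Complex.continuous_im.comp_continuousOn (hV.continuousOn.div
        (continuous_id.sub continuous_const).continuousOn fun w hw => sub_ne_zero.2 (hne hw))).neg
    obtain ⟨w, hw, hwmin⟩ := hK.exists_isMinOn ⟨z 0, rfl⟩ hcont
    refine ⟨_, ?_, fun t => hwmin (hlevel t)⟩
    change 0 < -(planarField h w / (w - z₀)).im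
    rw [im_planarField_div, neg_neg]
    exact div_pos (mul_pos two_pos (fderiv_sub_pos hh hconv hmin (hne hw)))
      (Complex.normSq_pos.2 (sub_ne_zero.2 (hne hw)))
  have hIm (t : ℝ) : HasDerivAt (fun t => -(L t).im) (-(ℓ t).im) t :=
    (Complex.imCLM.hasFDerivAt.comp_hasDerivAt t (hL t)).neg
  have hImc : Continuous fun t => -(L t).im :=
    continuous_iff_continuousAt.2 fun t => (hIm t).continuousAt
  obtain ⟨T, hT, hTL⟩ : ∃ T : ℝ, 0 < T ∧ -(L T).im = 2 * Real.pi := by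
    have hpos : 0 < 2 * Real.pi / c := div_pos Real.two_pi_pos hc
    have hgrow : 2 * Real.pi ≤ -(L (2 * Real.pi / c)).im := by
      have := mul_sub_le_image_sub_of_le_deriv (fun t => (hIm t).differentiableAt)
        (fun t => (hIm t).deriv.symm ▸ hcb t) hpos.le
      simpa [hL0, mul_div_cancel₀ _ hc.ne'] using this
    obtain ⟨T, ⟨hT0, -⟩, hT⟩ := intermediate_value_Icc hpos.le hImc.continuousOn
      (show 2 * Real.pi ∈ Set.Icc (-(L 0).im) (-(L (2 * Real.pi / c)).im) from
        ⟨by simp [hL0, Real.pi_pos.le], hgrow⟩)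
    refine ⟨T, lt_of_le_of_ne hT0 ?_, hT⟩
    rintro rfl
    simp [hL0, Real.pi_ne_zero] at hT
  have hexp : Complex.exp (L T) = (Real.exp (L T).re : ℝ) := by
    have : L T = ((L T).re : ℝ) + (-1 : ℤ) * (2 * Real.pi * Complex.I) := by
      apply Complex.ext
      · simp
      · simp; linarith
    conv_lhs => rw [this, Complex.exp_periodic.int_mul]
    rw [Complex.ofReal_exp]
  have hray : z T = z₀ + Real.exp (L T).re • (z 0 - z₀) := by
    have := hzL T
    rw [hexp] at this
    rw [Complex.real_smul, mul_comm, ← this]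
    ring
  have hr : Real.exp (L T).re = 1 := by
    refine eq_one_of_ray hconv hmin (sub_ne_zero.2 h0) (Real.exp_pos _) ?_
    rw [← hray, hlevel, add_sub_cancel]
  have hTz : z T = z 0 := by rw [hray, hr, one_smul, add_sub_cancel]
  refine ⟨T, hT, fun t => ?_⟩
  exact planarField_unique hh hlim Set.ordConnected_univ trivial (z := fun t => z (t + T))
    (fun t _ => ((hz (t + T)).comp_add_const t T).hasDerivWithinAt)
    (fun t _ => (hz t).hasDerivWithinAt) (by simpa using hTz) t trivial

/-- The minimum of `h` is the only zero of its Hamiltonian vector field. -/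
theorem planarField_eq_zero_iff (hh : ContDiff ℝ ∞ h) (hconv : StrictConvexOn ℝ Set.univ h)
    (hmin : ∀ z, h z₀ ≤ h z) {z : ℂ} : planarField h z = 0 ↔ z = z₀ := by
  constructor
  · intro hz
    by_contra hne
    have h1 := im_planarField_div h z (z - z₀)
    have h2 := div_pos (mul_pos two_pos (fderiv_sub_pos hh hconv hmin hne))
      (Complex.normSq_pos.2 (sub_ne_zero.2 hne))
    rw [hz, zero_div, Complex.zero_im] at h1
    linarith
  · rintro rfl
    have : fderiv ℝ h z = 0 := IsLocalMin.fderiv_eq_zero (Filter.Eventually.of_forall hmin)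
    apply Complex.ext <;> simp [planarField, this]

end Planar

end FramedConvex

/-! ### Positive sums of exponentials -/

section ExpSum

variable {ι : Type*} [Fintype ι]

/-- A Laurent polynomial in `exp (re z)` and `exp (im z)`, with exponents `(m k, n k)`. -/
noncomputable def expSum (c : ι → ℝ) (m n : ι → ℤ) (z : ℂ) : ℝ :=
  ∑ k, c k * Real.exp (m k * z.re + n k * z.im)

variable {c : ι → ℝ} {m n : ι → ℤ}

/-- The hypothesis on the exponents bounds their support function from below: it says that their
convex hull contains the closed unit disc. -/
theorem strictConvexOn_expSum (hc : ∀ k, 0 < c k)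
    (hmn : ∀ z : ℂ, ∃ k, ‖z‖ ≤ m k * z.re + n k * z.im) :
    StrictConvexOn ℝ Set.univ (expSum c m n) := by
  refine ⟨convex_univ, fun z _ w _ hzw a b ha hb hab => ?_⟩
  simp only [expSum, smul_eq_mul, Finset.mul_sum, ← Finset.sum_add_distrib]
  have e (k : ι) : (m k : ℝ) * (a • z + b • w).re + n k * (a • z + b • w).im =
      a • (m k * z.re + n k * z.im) + b • (m k * w.re + n k * w.im) := by
    simp; ring
  have key (k : ι) (x y : ℝ) : a * (c k * Real.exp x) + b * (c k * Real.exp y) =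
      c k * (a • Real.exp x + b • Real.exp y) := by
    rw [smul_eq_mul, smul_eq_mul]; ring
  simp only [e, key]
  refine Finset.sum_lt_sum (fun k _ => ?_) ?_
  · exact mul_le_mul_of_nonneg_left
      (convexOn_exp.2 (Set.mem_univ _) (Set.mem_univ _) ha.le hb.le hab) (hc k).le
  · obtain ⟨k, hk⟩ := hmn (z - w)
    refine ⟨k, Finset.mem_univ k, mul_lt_mul_of_pos_left
      (strictConvexOn_exp.2 (Set.mem_univ _) (Set.mem_univ _) ?_ ha hb hab) (hc k)⟩
    have := norm_pos_iff.2 (sub_ne_zero.2 hzw)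
    simp only [Complex.sub_re, Complex.sub_im] at hk
    intro h
    nlinarith

theorem tendsto_expSum [Nonempty ι] (hc : ∀ k, 0 < c k)
    (hmn : ∀ z : ℂ, ∃ k, ‖z‖ ≤ m k * z.re + n k * z.im) :
    Filter.Tendsto (expSum c m n) (Filter.cocompact ℂ) Filter.atTop := by
  obtain ⟨k₀, hk₀⟩ := Finite.exists_min c
  refine Filter.tendsto_atTop_mono (f := fun z => c k₀ * ‖z‖) (fun z => ?_)
    (Filter.Tendsto.const_mul_atTop (hc k₀) tendsto_norm_cocompact_atTop)
  obtain ⟨k, hk⟩ := hmn z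
  have h1 : ‖z‖ ≤ Real.exp (m k * z.re + n k * z.im) := by
    linarith [Real.add_one_le_exp (m k * z.re + n k * z.im : ℝ)]
  calc c k₀ * ‖z‖ ≤ c k * Real.exp (m k * z.re + n k * z.im) :=
        mul_le_mul (hk₀ k) h1 (norm_nonneg z) (hc k).le
    _ ≤ expSum c m n z := Finset.single_le_sum
        (f := fun k => c k * Real.exp (m k * z.re + n k * z.im))
        (fun j _ => (mul_pos (hc j) (Real.exp_pos _)).le) (Finset.mem_univ k)

end ExpSum

/-! ### The trace of the figure eight curve on a symplectic leaf -/

namespace FramedConvex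

/-- The exponents of `exp a` in the trace of the figure eight curve on a leaf. -/
def traceExpU : Fin 12 → ℤ := ![-2, -1, 0, 1, -2, -1, 0, 1, -2, -1, 0, 1]

/-- The exponents of `exp b` in the trace of the figure eight curve on a leaf. -/
def traceExpV : Fin 12 → ℤ := ![1, 1, 1, 1, 0, 0, 0, 0, -1, -1, -1, -1]

/-- The coefficients of the trace of the figure eight curve on the leaf through the point with
coordinates `y`. -/
noncomputable def traceCoeff (y : Fin 8 → ℝ) (k : Fin 12) : ℝ :=
  (y 0 ^ 4 * y 1 ^ 2 * y 2 * y 3 ^ 2 * y 4 * y 5 ^ 2 * y 6 ^ 3 * y 7 ^ 3) ^ (-1 / 3 : ℝ) *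
    ![y 0 * y 1 * y 3 * y 5 * y 6,
      y 0 * y 1 * y 3 * y 5 * y 6 * (y 0 + y 2 + y 4),
      y 0 * y 1 * y 3 * y 5 * y 6 * (y 0 * y 2 + y 0 * y 4 + y 2 * y 4),
      y 0 * y 1 * y 3 * y 5 * y 6 * (y 0 * y 2 * y 4),
      y 0 * y 1 * y 3 * y 5 * y 6 * y 7 * 2,
      y 0 * y 1 * y 5 * y 6 * y 7 * (1 + y 3 * y 4) +
        y 0 * y 3 * y 6 * y 7 * (y 1 * (1 + y 0 * y 5) + y 5 * (1 + y 1 * y 2)),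
      y 6 ^ 2 * y 7 ^ 2 * (1 + y 0 * y 5) + y 0 * y 1 * y 4 * y 5 * y 6 * y 7 +
        y 0 * y 3 * y 6 * y 7 * (1 + y 1 * y 2) * (1 + y 0 * y 5) +
        y 0 ^ 2 * y 1 * y 3 * y 4 * y 5 * (1 + y 1 * y 2),
      y 0 * y 6 ^ 2 * y 7 ^ 2 + y 0 ^ 2 * y 1 * y 2 * y 3 * y 4 * y 5,
      y 0 * y 6 * y 7 ^ 2 * (y 1 * y 3 * y 5),
      y 0 * y 6 * y 7 ^ 2 * (y 1 * y 3 + y 1 * y 5 + y 3 * y 5),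
      y 0 * y 6 * y 7 ^ 2 * (y 1 + y 3 + y 5),
      y 0 * y 6 * y 7 ^ 2] k

theorem traceCoeff_pos {y : Fin 8 → ℝ} (hy : y ∈ orthant) (k : Fin 12) : 0 < traceCoeff y k := by
  have h0 := hy 0
  have h1 := hy 1
  have h2 := hy 2
  have h3 := hy 3
  have h4 := hy 4
  have h5 := hy 5
  have h6 := hy 6
  have h7 := hy 7
  refine mul_pos (by positivity) ?_
  fin_cases k <;> simp only [Fin.reduceFinMk, Matrix.cons_val] <;> positivity

theorem exists_norm_le (z : ℂ) : ∃ k, ‖z‖ ≤ traceExpU k * z.re + traceExpV k * z.im := by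
  have h := Complex.norm_le_abs_re_add_abs_im z
  rcases le_total 0 z.re with ha | ha <;> rcases le_total 0 z.im with hb | hb
  · exact ⟨3, by simp [traceExpU, traceExpV]; rw [abs_of_nonneg ha, abs_of_nonneg hb] at h; linarith⟩
  · exact ⟨11, by simp [traceExpU, traceExpV]; rw [abs_of_nonneg ha, abs_of_nonpos hb] at h; linarith⟩
  · exact ⟨0, by simp [traceExpU, traceExpV]; rw [abs_of_nonpos ha, abs_of_nonneg hb] at h; linarith⟩
  · exact ⟨8, by simp [traceExpU, traceExpV]; rw [abs_of_nonpos ha, abs_of_nonpos hb] at h; linarith⟩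

/-- The cube root in the trace is a Casimir function. -/
theorem leafForm_casimir (y : Fin 8 → ℝ) (z : ℂ) :
    leafForm y z 0 ^ 4 * leafForm y z 1 ^ 2 * leafForm y z 2 * leafForm y z 3 ^ 2 *
      leafForm y z 4 * leafForm y z 5 ^ 2 * leafForm y z 6 ^ 3 * leafForm y z 7 ^ 3 =
    y 0 ^ 4 * y 1 ^ 2 * y 2 * y 3 ^ 2 * y 4 * y 5 ^ 2 * y 6 ^ 3 * y 7 ^ 3 := by
  have hA := Real.exp_ne_zero z.re
  have hB := Real.exp_ne_zero z.im
  simp [leafForm, leafU, leafV, Real.exp_neg]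
  field_simp

theorem traceForm_leafForm (y : Fin 8 → ℝ) (z : ℂ) :
    traceForm (leafForm y z) = expSum (traceCoeff y) traceExpU traceExpV z := by
  rw [traceForm, leafForm_casimir]
  have hA := Real.exp_ne_zero z.re
  have hB := Real.exp_ne_zero z.im
  have h2 : Real.exp (2 * z.re) = Real.exp z.re ^ 2 := by rw [two_mul, Real.exp_add, sq]
  simp only [expSum, traceCoeff]
  generalize (y 0 ^ 4 * y 1 ^ 2 * y 2 * y 3 ^ 2 * y 4 * y 5 ^ 2 * y 6 ^ 3 * y 7 ^ 3) ^
    (-1 / 3 : ℝ) = r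
  simp [leafForm, leafU, leafV, Real.exp_neg, Real.exp_add, Fin.sum_univ_succ, traceExpU,
    traceExpV, h2]
  generalize Real.exp z.re = A at *
  generalize Real.exp z.im = B at *
  field_simp
  ring

theorem contDiffOn_traceForm : ContDiffOn ℝ ∞ traceForm orthant := by
  have h (i : Fin 8) : ContDiffOn ℝ ∞ (fun y : Fin 8 → ℝ => y i) orthant :=
    (contDiff_apply ℝ ℝ i).contDiffOn
  unfold traceForm
  refine ContDiffOn.mul (ContDiffOn.rpow_const_of_ne ?_ fun y hy => ?_) ?_
  · fun_prop
  · have h0 := hy 0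
    have h1 := hy 1
    have h2 := hy 2
    have h3 := hy 3
    have h4 := hy 4
    have h5 := hy 5
    have h6 := hy 6
    have h7 := hy 7
    positivity
  · fun_prop

theorem isSmooth_tr_figureEight : IsSmooth (tr figureEight) :=
  isSmooth_of_contDiffOn contDiffOn_traceForm tr_figureEight

theorem tr_comp_leafPt (p : FramedConvex) : tr figureEight ∘ leafPt p =
    expSum (traceCoeff (coords p)) traceExpU traceExpV := by
  ext z
  rw [Function.comp_apply, tr_figureEight, coords_leafPt, traceForm_leafForm]

end FramedConvex

end Pants

theorem theoremA (Q : Set Pants.FramedConvex) (hQ : Pants.FramedConvex.IsSymplecticLeaf Q) :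
    Pants.IsEmbeddedSurface (Pants.FramedConvex.coords '' Q) ∧
    Pants.FramedConvex.IsSmooth (Pants.FramedConvex.tr Pants.figureEight) ∧
    (∃! q : Q, ∀ q' : Q, Pants.FramedConvex.tr Pants.figureEight q ≤
      Pants.FramedConvex.tr Pants.figureEight q') ∧
    ∃ Φ : ℝ → Q → Q,
      Pants.FramedConvex.IsHamiltonianFlow (Pants.FramedConvex.tr Pants.figureEight) Q Φ ∧
      (∀ q, ∃ T : ℝ, 0 < T ∧ Function.Periodic (fun t => Φ t q) T) ∧
      ∃! q, ∀ t, Φ t q = q := by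
  open Pants Pants.FramedConvex in
  obtain ⟨p, rfl⟩ := hQ
  rw [leaf_eq_range]
  have hsm : IsSmooth (tr figureEight) := isSmooth_tr_figureEight
  set h : ℂ → ℝ := tr figureEight ∘ leafPt p with hh
  have hh' : ContDiff ℝ ∞ h := hsm.contDiff_comp_leafPt p
  have hconv : StrictConvexOn ℝ Set.univ h := by
    rw [hh, tr_comp_leafPt]
    exact strictConvexOn_expSum (traceCoeff_pos (coords_pos p)) exists_norm_le
  have hlim : Filter.Tendsto h (Filter.cocompact ℂ) Filter.atTop := by
    rw [hh, tr_comp_leafPt]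
    exact tendsto_expSum (traceCoeff_pos (coords_pos p)) exists_norm_le
  obtain ⟨z₀, hmin⟩ := hh'.continuous.exists_forall_le hlim
  choose φ hφ0 hφ using exists_planar_curve hh' hlim
  let e : ℂ ≃ Set.range (leafPt p) := Equiv.ofInjective _ (leafPt_injective p)
  have he (z : ℂ) : (e z : FramedConvex) = leafPt p z := rfl
  have hfix (z : ℂ) : (∀ t, φ z t = z) ↔ z = z₀ := by
    rw [← planarField_eq_zero_iff hh' hconv hmin]
    constructor
    · intro hz
      have h1 := hφ z 0
      rw [funext hz] at h1
      exact (h1.unique (hasDerivAt_const 0 z))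
    · intro hz t
      exact planarField_unique hh' hlim Set.ordConnected_univ trivial
        (fun t _ => (hφ z t).hasDerivWithinAt) (w := fun _ => z)
        (fun t _ => by rw [hz]; exact hasDerivWithinAt_const _ _ _) (hφ0 z) t trivial
  refine ⟨?_, hsm, ⟨e z₀, ?_, ?_⟩, fun t q => e (φ (e.symm q) t), ⟨?_, ?_, ?_⟩, ?_, e z₀, ?_, ?_⟩
  · have : coords '' Set.range (leafPt p) = Set.range (leafForm (coords p)) := by
      rw [← Set.range_comp]
      exact congrArg Set.range (funext fun z => coords_leafPt p z)
    rw [this]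
    exact isEmbeddedSurface_range_leafForm (coords_pos p)
  · intro q
    obtain ⟨z, rfl⟩ := e.surjective q
    exact hmin z
  · intro q hq
    obtain ⟨z, rfl⟩ := e.surjective q
    rw [hconv.eq_of_isMinOn (fun w _ => hq (e w)) (fun w _ => hmin w) trivial trivial]
  · intro q
    simp [hφ0]
  · intro q
    exact hsm.isHamiltonianCurveOn_leafPt fun t _ => (hφ (e.symm q) t).hasDerivWithinAt
  · intro q c s hs h0 hc hq t ht
    obtain ⟨z, rfl⟩ := e.surjective q
    obtain ⟨w, hw0, hw⟩ := hsm.exists_lift hs h0 hc hq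
    rw [(hw t ht).1, he, e.symm_apply_apply]
    exact congrArg (leafPt p) (planarField_unique hh' hlim hs h0 (fun t ht => (hw t ht).2)
      (fun t _ => (hφ z t).hasDerivWithinAt) (by rw [hw0, hφ0]) t ht)
  · intro q
    obtain ⟨z, rfl⟩ := e.surjective q
    simp only [e.symm_apply_apply]
    by_cases hz : z = z₀
    · exact ⟨1, one_pos, fun t => by simp only [(hfix z).2 hz]⟩
    · obtain ⟨T, hT, hper⟩ := exists_periodic hh' hconv hlim hmin (hφ z) (by rwa [hφ0])
      exact ⟨T, hT, fun t => by simp only [hper t]⟩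
  · intro t
    simp only [e.symm_apply_apply, (hfix z₀).2 rfl t]
  · intro q hq
    obtain ⟨z, rfl⟩ := e.surjective q
    simp only [e.symm_apply_apply, e.injective.eq_iff] at hq
    rw [(hfix z).1 hq]
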